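/- For a matroid $M$ on $\{1,\dots,n\}$ let $\mathscr P(M)\subseteq\mathbb R^n$ be its basis polytope, the convex hull of the indicator vectors of the bases of $M$. Its Ehrhart polynomial $\operatorname{ehr}(M,t)\in\mathbb{Q}[t]$ is the polynomial with $\operatorname{ehr}(M,t)=\#\left(t\,\mathscr P(M)\cap\mathbb Z^n\right)$ for all integers $t\ge 0$. The matroid $M$ is called Ehrhart positive if all coefficients of $\operatorname{ehr}(M,t)$, from the constant one up to the leading one, are positive. Theorem. If $n\ge 3589$ and $3\le k\le n-3$, or if $n\ge 104$ and $4\le k\le n-4$, then there is a connected matroid $M$ of rank $k$ on $n$ elements that is not Ehrhart positive; more precisely, the coefficient of $t^2$ in $\operatorname{ehr}(M,t)$ is negative. Here connected means that $M$ is not a direct sum of two matroids with nonempty ground sets. -/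

import Mathlib

/-- The basis polytope of a matroid: the convex hull in `ℝ^α` of the indicator vectors of its
bases. -/
def basisPolytope {α : Type*} (M : Matroid α) : Set (α → ℝ) :=
  convexHull ℝ {v | ∃ B : Set α, M.IsBase B ∧ v = B.indicator (fun _ => (1 : ℝ))}

/-- The set of integer points of the dilation `t P` of a subset `P` of `ℝ^α`. -/
def latticePoints {α : Type*} (P : Set (α → ℝ)) (t : ℕ) : Set (α → ℤ) :=
  {x | ∃ y ∈ P, ∀ i, (x i : ℝ) = (t : ℝ) * y i}

/-- `p` is the Ehrhart polynomial of `P`: for every `t = 0, 1, 2, …` the dilation `t P` contains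
finitely many integer points, and their number is `p(t)`. At most one polynomial has this
property, since a polynomial is determined by its values at infinitely many points. -/
def IsEhrhartPolynomial {α : Type*} (P : Set (α → ℝ)) (p : Polynomial ℚ) : Prop :=
  ∀ t : ℕ, (latticePoints P t).Finite ∧ p.eval (t : ℚ) = ((latticePoints P t).ncard : ℚ)

/-- `P` has an Ehrhart polynomial, and all of its coefficients, from the constant one up to the
leading one, are positive. -/
def EhrhartPositive {α : Type*} (P : Set (α → ℝ)) : Prop :=
  ∃ p : Polynomial ℚ, IsEhrhartPolynomial P p ∧ ∀ i ≤ p.natDegree, 0 < p.coeff i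

/-- A matroid is connected if it is not the direct sum of two matroids with nonempty ground
sets. -/
def MatroidConnected {α : Type*} (M : Matroid α) : Prop :=
  ∀ (M₁ M₂ : Matroid α) (h : Disjoint M₁.E M₂.E),
    M = M₁.disjointSum M₂ h → M₁.E = ∅ ∨ M₂.E = ∅

/-! Take all `k`-sets as bases except a family `C` no two of whose members differ by a single
exchange. This gives a sparse paving matroid. Its polytope is the hypersimplex with one corner, `∑ i
∈ H, y i > k - 1`, cut off for each `H ∈ C`. The corners are pairwise disjoint and contain equally
many lattice points after dilation, so the Ehrhart polynomial is `hypersimplexPoly - #C * cutPoly`.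

Sorting the `k`-sets by their sum modulo `n` yields such a family with `n * #C ≥ n.choose k`. Write
`k = a + 1`, `n = a + b + 2`; complementing coordinates allows `a ≤ b`. The quadratic coefficient of
the hypersimplex is at most `k ^ 2` times the second elementary symmetric function of `1, …,
1/(n-1)`, hence of order `k ^ 2 (log n) ^ 2`. The corners remove at least `1 / ((a+1)(b+1))` times a
sum of binomial coefficients. For rank 3 this grows like `n / 12`, for rank 4 like `n ^ 2 / 72`, and
for higher ranks a crude estimate is enough. The thresholds 3589 and 104 come from ranks 3 and 4,
where the comparison is made by explicit numerical bounds on harmonic sums, followed by induction.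

The main steps are `mem_basisPolytope_matroid_iff` (facets), `latticePoints_finite_and_ncard`
(counting), `hypersimplexPoly_coeff_two` and `cutPoly_coeff_two` (coefficients) and `coeff_two_lt`
(comparison). -/

open Finset in
/-- A family of `k`-element sets, no two of which differ by the exchange of a single element. -/
structure IsExchangeFree {α : Type*} [DecidableEq α] (k : ℕ) (C : Finset (Finset α)) : Prop where
  card_eq : ∀ H ∈ C, #H = k
  eq_of_insert : ∀ (A : Finset α) (a b : α), a ∉ A → b ∉ A → insert a A ∈ C → insert b A ∈ C → a = b

/-! ### Sparse paving matroids and their connectedness -/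

namespace IsExchangeFree

open Finset

variable {α : Type*} [DecidableEq α] {k : ℕ} {C : Finset (Finset α)}

/-- If every exchange of `a` landed in `C`, all the incoming elements would coincide. Then `Y \ X`
would be a single element and `Y` itself would be that exchange, hence in `C`. -/
theorem exists_exchange (hC : IsExchangeFree k C) {X Y : Finset α} (hX : #X = k) (hY : #Y = k)
    (hYC : Y ∉ C) {a : α} (haX : a ∈ X) (haY : a ∉ Y) :
    ∃ b ∈ Y, b ∉ X ∧ insert b (X.erase a) ∉ C := by
  by_contra! hcon
  have hcard : #(X \ Y) = #(Y \ X) := card_sdiff_comm (hX.trans hY.symm)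
  have hpos : 0 < #(Y \ X) := hcard ▸ card_pos.2 ⟨a, mem_sdiff.2 ⟨haX, haY⟩⟩
  obtain ⟨b, hb⟩ := card_pos.1 hpos
  rw [mem_sdiff] at hb
  have huniq : ∀ b' ∈ Y \ X, b' = b := by
    intro b' hb'
    rw [mem_sdiff] at hb'
    exact hC.eq_of_insert (X.erase a) b' b (fun h ↦ hb'.2 (mem_of_mem_erase h))
      (fun h ↦ hb.2 (mem_of_mem_erase h)) (hcon _ hb'.1 hb'.2) (hcon _ hb.1 hb.2)
  have hYX : Y ⊆ insert b (X.erase a) := by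
    intro y hy
    by_cases hyX : y ∈ X
    · exact mem_insert_of_mem (mem_erase.2 ⟨fun h ↦ haY (h ▸ hy), hyX⟩)
    · exact mem_insert.2 (Or.inl (huniq y (mem_sdiff.2 ⟨hy, hyX⟩)))
  have : Y = insert b (X.erase a) := by
    refine eq_of_subset_of_card_le hYX ?_
    rw [card_insert_of_notMem (fun h ↦ hb.2 (mem_of_mem_erase h)), card_erase_add_one haX, hX, hY]
  exact hYC (this ▸ hcon b hb.1 hb.2)

theorem insert_notMem_or (hC : IsExchangeFree k C) {A : Finset α} {a b : α} (ha : a ∉ A)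
    (hb : b ∉ A) (hab : a ≠ b) : insert a A ∉ C ∨ insert b A ∉ C := by
  by_contra! h
  exact hab (hC.eq_of_insert A a b ha hb h.1 h.2)

variable [Fintype α]

theorem exists_card_eq_notMem (hC : IsExchangeFree k C) (hk : 1 ≤ k)
    (hkn : k + 1 ≤ Fintype.card α) : ∃ B : Finset α, #B = k ∧ B ∉ C := by
  obtain ⟨S, -, hS⟩ := exists_subset_card_eq (s := (univ : Finset α)) (n := k + 1)
    (by simpa using hkn)
  obtain ⟨a, b, ha, hb, hab⟩ := one_lt_card_iff.1 (show 1 < #S by omega)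
  have hbS : b ∈ S.erase a := mem_erase.2 ⟨hab.symm, hb⟩
  have hA : #((S.erase a).erase b) + 1 = k := by
    rw [card_erase_add_one hbS, card_erase_of_mem ha, hS]; rfl
  have haA : a ∉ (S.erase a).erase b := by simp
  have hbA : b ∉ (S.erase a).erase b := by simp
  rcases hC.insert_notMem_or haA hbA hab with h | h
  · exact ⟨_, by rw [card_insert_of_notMem haA, hA], h⟩
  · exact ⟨_, by rw [card_insert_of_notMem hbA, hA], h⟩

/-- The sparse paving matroid whose bases are the `k`-element sets outside an exchange free
family. -/
def matroid (hC : IsExchangeFree k C) (hk : 1 ≤ k) (hkn : k + 1 ≤ Fintype.card α) : Matroid α :=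
  Matroid.ofIsBaseOfFinite (E := Set.univ) Set.finite_univ
    (fun B ↦ ∃ F : Finset α, (F : Set α) = B ∧ #F = k ∧ F ∉ C)
    (by
      obtain ⟨B, hB, hBC⟩ := hC.exists_card_eq_notMem hk hkn
      exact ⟨B, B, rfl, hB, hBC⟩)
    (by
      rintro _ _ ⟨X, rfl, hX, -⟩ ⟨Y, rfl, hY, hYC⟩ a ⟨haX, haY⟩
      rw [mem_coe] at haX haY
      obtain ⟨b, hbY, hbX, hb⟩ := hC.exists_exchange hX hY hYC haX haY
      refine ⟨b, ⟨hbY, hbX⟩, insert b (X.erase a), by simp, ?_, hb⟩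
      rw [card_insert_of_notMem (fun h ↦ hbX (mem_of_mem_erase h)), card_erase_add_one haX, hX])
    (fun B _ ↦ Set.subset_univ B)

theorem matroid_eRank (hC : IsExchangeFree k C) (hk : 1 ≤ k) (hkn : k + 1 ≤ Fintype.card α) :
    (hC.matroid hk hkn).eRank = k := by
  obtain ⟨B, hB, hBC⟩ := hC.exists_card_eq_notMem hk hkn
  have : (hC.matroid hk hkn).IsBase (B : Set α) := ⟨B, rfl, hB, hBC⟩
  rw [← this.encard_eq_eRank, Set.encard_coe_eq_coe_finsetCard, hB]

/-- Any two elements can be exchanged between two sets outside the family. -/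
theorem exists_insert_notMem_insert_notMem (hC : IsExchangeFree k C) (hk : 2 ≤ k)
    (hkn : k + 3 ≤ Fintype.card α) {e f : α} (hef : e ≠ f) :
    ∃ A : Finset α, e ∉ A ∧ f ∉ A ∧ #A + 1 = k ∧ insert e A ∉ C ∧ insert f A ∉ C := by
  have hcard : #((univ.erase e).erase f) + 2 = Fintype.card α := by
    rw [card_erase_of_mem (by simpa using hef.symm), card_erase_of_mem (mem_univ e), card_univ]
    omega
  obtain ⟨S, hSU, hS⟩ := exists_subset_card_eq (s := (univ.erase e).erase f) (n := k + 1) (by omega)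
  -- With `D` of size `k - 2`, each of `e` and `f` excludes at most one of the three candidates `a`,
  -- `b`, `c` as the last element, so one candidate suits both.
  obtain ⟨a, b, c, ha, hb, hc, hab, hac, hbc⟩ := two_lt_card_iff.1 (show 2 < #S by omega)
  set D := ((S.erase a).erase b).erase c with hD
  have hDc : #D + 2 = k := by
    rw [hD, card_erase_of_mem (by simp [hac.symm, hbc.symm, hc]),
      card_erase_of_mem (by simp [hab.symm, hb]), card_erase_of_mem ha, hS]
    omega
  have hS' : ∀ x ∈ S, x ≠ e ∧ x ≠ f := by
    intro x hx
    have := hSU hx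
    simp only [mem_erase, mem_univ, and_true] at this
    exact this.symm
  have haD : a ∉ D := by simp [hD]
  have hbD : b ∉ D := by simp [hD]
  have hcD : c ∉ D := by simp [hD]
  have heD : e ∉ D := fun h ↦
    (hS' e (mem_of_mem_erase (mem_of_mem_erase (mem_of_mem_erase h)))).1 rfl
  have hfD : f ∉ D := fun h ↦
    (hS' f (mem_of_mem_erase (mem_of_mem_erase (mem_of_mem_erase h)))).2 rfl
  have key : ∀ g, g ∉ D → (∀ x ∈ S, x ≠ g) → ∀ x ∈ S, ∀ y ∈ S, x ∉ D → y ∉ D → x ≠ y →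
      insert g (insert x D) ∉ C ∨ insert g (insert y D) ∉ C := by
    intro g hg hgS x hx y hy hxD hyD hxy
    rw [insert_comm g x, insert_comm g y]
    exact hC.insert_notMem_or (by simp [hgS x hx, hxD]) (by simp [hgS y hy, hyD]) hxy
  have good : ∀ x ∈ S, x ∉ D → insert e (insert x D) ∉ C → insert f (insert x D) ∉ C →
      ∃ A : Finset α, e ∉ A ∧ f ∉ A ∧ #A + 1 = k ∧ insert e A ∉ C ∧ insert f A ∉ C := by
    intro x hx hxD h1 h2
    refine ⟨insert x D, ?_, ?_, ?_, h1, h2⟩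
    · simp [(hS' x hx).1.symm, heD]
    · simp [(hS' x hx).2.symm, hfD]
    · rw [card_insert_of_notMem hxD]; omega
  have e1 := key e heD (fun x hx ↦ (hS' x hx).1)
  have f1 := key f hfD (fun x hx ↦ (hS' x hx).2)
  by_cases ea : insert e (insert a D) ∈ C
  · have eb := (e1 a ha b hb haD hbD hab).resolve_left (not_not.2 ea)
    have ec := (e1 a ha c hc haD hcD hac).resolve_left (not_not.2 ea)
    rcases f1 b hb c hc hbD hcD hbc with h | h
    · exact good b hb hbD eb h
    · exact good c hc hcD ec h
  · by_cases fa : insert f (insert a D) ∈ C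
    · have fb := (f1 a ha b hb haD hbD hab).resolve_left (not_not.2 fa)
      have fc := (f1 a ha c hc haD hcD hac).resolve_left (not_not.2 fa)
      rcases e1 b hb c hc hbD hcD hbc with h | h
      · exact good b hb hbD h fb
      · exact good c hc hcD h fc
    · exact good a ha haD ea fa

/-- If `e` and `f` lay in different summands, the bases `A + e` and `A + f` would restrict to bases
of the first summand of different sizes. -/
theorem matroidConnected_matroid (hC : IsExchangeFree k C) (hk : 2 ≤ k)
    (hkn : k + 3 ≤ Fintype.card α) :
    MatroidConnected (hC.matroid (by omega) (by omega)) := by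
  intro M₁ M₂ hdisj hM
  by_contra! hne
  obtain ⟨⟨e, he⟩, ⟨f, hf⟩⟩ := hne
  have hef : e ≠ f := fun h ↦ Set.disjoint_left.1 hdisj he (h ▸ hf)
  have hf1 : f ∉ M₁.E := fun h ↦ Set.disjoint_left.1 hdisj h hf
  obtain ⟨A, heA, hfA, hA, h1, h2⟩ := hC.exists_insert_notMem_insert_notMem hk hkn hef
  have base : ∀ g, g ∉ A → insert g A ∉ C → M₁.IsBase ((insert g A : Finset α) ∩ M₁.E) := by
    intro g hg hgC
    have : (hC.matroid (by omega) (by omega)).IsBase ((insert g A : Finset α) : Set α) :=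
      ⟨_, rfl, by rw [card_insert_of_notMem hg, hA], hgC⟩
    rw [hM, Matroid.disjointSum_isBase_iff] at this
    exact this.1
  have he' := base e heA h1
  have hf' := base f hfA h2
  have hcard := he'.encard_eq_eRank.trans hf'.encard_eq_eRank.symm
  rw [coe_insert, coe_insert, Set.insert_inter_of_mem he, Set.insert_inter_of_notMem hf1,
    Set.encard_insert_of_notMem (fun h ↦ heA h.1)] at hcard
  have hfin : ((A : Set α) ∩ M₁.E).Finite := Set.toFinite _
  rw [hfin.encard_eq_coe_toFinset_card] at hcard
  norm_cast at hcard
  omega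

end IsExchangeFree

/-! ### Large exchange free families -/

open Finset in
/-- Some class of `k`-element subsets of `{0, …, n - 1}` with prescribed sum modulo `n` contains
at least the average number of them. -/
theorem exists_isExchangeFree (n k : ℕ) (hn : 0 < n) :
    ∃ C : Finset (Finset (Fin n)), IsExchangeFree k C ∧ n.choose k ≤ n * #C := by
  have : NeZero n := ⟨hn.ne'⟩
  let f : Finset (Fin n) → ZMod n := fun B ↦ ∑ i ∈ B, ((i : ℕ) : ZMod n)
  let S : Finset (Finset (Fin n)) := powersetCard k univ
  obtain ⟨y, -, hy⟩ : ∃ y ∈ (univ : Finset (ZMod n)),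
      (n.choose k : ℚ) / n ≤ #{x ∈ S | f x = y} := by
    refine exists_le_card_fiber_of_nsmul_le_card_of_maps_to (fun _ _ ↦ mem_univ _) univ_nonempty ?_
    simp only [S, card_univ, ZMod.card, card_powersetCard, Fintype.card_fin, nsmul_eq_mul]
    rw [mul_div_cancel₀ _ (by positivity)]
  refine ⟨{x ∈ S | f x = y}, ⟨?_, ?_⟩, ?_⟩
  · intro H hH
    exact (mem_powersetCard.1 (mem_filter.1 hH).1).2
  · intro A a b ha hb hA hB
    have h1 := (mem_filter.1 hA).2
    have h2 := (mem_filter.1 hB).2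
    simp only [f, sum_insert ha] at h1
    simp only [f, sum_insert hb] at h2
    -- Sets differing by one exchange and having equal sums exchange congruent elements, and
    -- residues determine elements of `Fin n`.
    have h3 : (((a : ℕ) : ZMod n)) = ((b : ℕ) : ZMod n) := add_right_cancel (h1.trans h2.symm)
    rw [ZMod.natCast_eq_natCast_iff'] at h3
    rw [Nat.mod_eq_of_lt a.2, Nat.mod_eq_of_lt b.2] at h3
    exact Fin.ext h3
  · rw [div_le_iff₀ (by positivity)] at hy
    rw [mul_comm]
    exact_mod_cast hy

open Finset

/-! ### Vertices of the hypersimplex via Birkhoff's theorem -/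

section Hypersimplex

variable {α : Type*} [Fintype α] [DecidableEq α] {k : ℕ}

/-- Every point of the hypersimplex is a convex combination of indicator vectors of `k`-element
sets. -/
theorem exists_weights_of_mem_hypersimplex (hk : 1 ≤ k) (hkn : k + 1 ≤ Fintype.card α)
    {y : α → ℝ} (h0 : ∀ i, 0 ≤ y i) (h1 : ∀ i, y i ≤ 1) (hsum : ∑ i, y i = k) :
    ∃ c : Finset α → ℝ, (∀ B, 0 ≤ c B) ∧ ∑ B, c B = 1 ∧ (∀ B, #B ≠ k → c B = 0) ∧
      ∀ i, ∑ B, c B * (if i ∈ B then 1 else 0) = y i := by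
  obtain ⟨R, -, hR⟩ := exists_subset_card_eq (s := (univ : Finset α)) (n := k)
    (by rw [card_univ]; omega)
  have hk0 : (0 : ℝ) < k := by exact_mod_cast hk
  have hnk : (0 : ℝ) < (Fintype.card α : ℝ) - k := by
    rw [sub_pos]; exact_mod_cast hkn
  have hRc : (#Rᶜ : ℝ) = (Fintype.card α : ℝ) - k := by
    rw [card_compl, hR, Nat.cast_sub (by omega)]
  -- The `k` rows in `R` add up to `y`, and the remaining rows make the matrix doubly stochastic. In
  -- a permutation matrix the rows in `R` add up to the indicator of a `k`-set, so Birkhoff's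
  -- decomposition gives the weights.
  let M : Matrix α α ℝ := fun r i ↦
    if r ∈ R then y i / k else (1 - y i) / ((Fintype.card α : ℝ) - k)
  have hM : M ∈ doublyStochastic ℝ α := by
    rw [mem_doublyStochastic_iff_sum]
    refine ⟨fun r i ↦ ?_, fun r ↦ ?_, fun i ↦ ?_⟩
    · simp only [M]
      split_ifs
      · exact div_nonneg (h0 i) hk0.le
      · exact div_nonneg (sub_nonneg.2 (h1 i)) hnk.le
    · simp only [M]
      split_ifs
      · rw [← sum_div, hsum, div_self hk0.ne']
      · rw [← sum_div, sum_sub_distrib, hsum]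
        simp only [sum_const, card_univ, nsmul_eq_mul, mul_one]
        rw [div_self hnk.ne']
    · rw [← sum_add_sum_compl R]
      have e1 : ∑ r ∈ R, M r i = ∑ r ∈ R, y i / k :=
        sum_congr rfl fun r hr ↦ by simp [M, hr]
      have e2 : ∑ r ∈ Rᶜ, M r i = ∑ r ∈ Rᶜ, (1 - y i) / ((Fintype.card α : ℝ) - k) :=
        sum_congr rfl fun r hr ↦ by simp [M, mem_compl.1 hr]
      rw [e1, e2, sum_const, sum_const, nsmul_eq_mul, nsmul_eq_mul, hR, hRc]
      field_simp
      ring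
  obtain ⟨w, hw0, hw1, hw⟩ := exists_eq_sum_perm_of_mem_doublyStochastic hM
  let g : Equiv.Perm α → Finset α := fun σ ↦ R.map σ.toEmbedding
  refine ⟨fun B ↦ ∑ σ with g σ = B, w σ, fun B ↦ sum_nonneg fun σ _ ↦ hw0 σ, ?_, ?_, ?_⟩
  · rw [sum_fiberwise, hw1]
  · intro B hB
    refine sum_eq_zero fun σ hσ ↦ absurd ?_ hB
    rw [← (mem_filter.1 hσ).2, card_map, hR]
  · intro i
    have e1 : ∀ B, (∑ σ with g σ = B, w σ) * (if i ∈ B then 1 else 0) =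
        ∑ σ with g σ = B, w σ * (if i ∈ g σ then 1 else 0) := by
      intro B
      rw [sum_mul]
      exact sum_congr rfl fun σ hσ ↦ by rw [(mem_filter.1 hσ).2]
    simp_rw [e1]
    rw [sum_fiberwise]
    have e2 : y i = ∑ r ∈ R, M r i := by
      have : ∑ r ∈ R, M r i = ∑ r ∈ R, y i / k :=
        sum_congr rfl fun r hr ↦ by simp [M, hr]
      rw [this, sum_const, nsmul_eq_mul, hR]
      field_simp
    rw [e2, ← hw]
    simp only [Matrix.sum_apply, Matrix.smul_apply, smul_eq_mul]
    rw [sum_comm]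
    refine sum_congr rfl fun σ _ ↦ ?_
    rw [← mul_sum]
    congr 1
    simp only [Equiv.Perm.permMatrix, PEquiv.toMatrix_apply, Equiv.toPEquiv_apply, Option.mem_def,
      Option.some.injEq]
    by_cases hi : i ∈ g σ
    · obtain ⟨r, hr, hri⟩ := mem_map.1 hi
      rw [if_pos hi, sum_eq_single_of_mem r hr]
      · exact (if_pos hri).symm
      · intro r' _ hr'
        exact if_neg fun h ↦ hr' (σ.injective (h.trans hri.symm))
    · rw [if_neg hi]
      refine (sum_eq_zero fun r hr ↦ if_neg fun h ↦ hi ?_).symm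
      exact mem_map.2 ⟨r, hr, h⟩

end Hypersimplex

/-! ### Inequalities for the basis polytope -/

namespace IsExchangeFree

variable {α : Type*} [Fintype α] [DecidableEq α] {k : ℕ} {C : Finset (Finset α)}

/-- Among the representations of `y` by `k`-sets, a compact set, choose one with least total weight
on `C`. If some `H ∈ C` had positive weight, a symmetric exchange with another set in the support
would move weight off `C`. -/
theorem exists_weights_of_sum_le (hC : IsExchangeFree k C) (hk : 1 ≤ k)
    (hkn : k + 1 ≤ Fintype.card α) {y : α → ℝ} (h0 : ∀ i, 0 ≤ y i) (h1 : ∀ i, y i ≤ 1)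
    (hsum : ∑ i, y i = k) (hH : ∀ H ∈ C, ∑ i ∈ H, y i ≤ k - 1) :
    ∃ c : Finset α → ℝ, (∀ B, 0 ≤ c B) ∧ ∑ B, c B = 1 ∧ (∀ B, ¬ (#B = k ∧ B ∉ C) → c B = 0) ∧
      ∀ i, ∑ B, c B * (if i ∈ B then 1 else 0) = y i := by
  let K : Set (Finset α → ℝ) := {c | (∀ B, #B ≠ k → c B = 0) ∧
      ∀ i, ∑ B, c B * (if i ∈ B then 1 else 0) = y i}
  have hK : IsClosed K := by
    have hK' : K = (⋂ B : Finset α, ⋂ _ : #B ≠ k, {c | c B = 0}) ∩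
        ⋂ i, {c | ∑ B, c B * (if i ∈ B then 1 else 0) = y i} := by
      ext c
      simp [K]
    rw [hK']
    refine IsClosed.inter ?_ ?_
    · refine isClosed_iInter fun B ↦ isClosed_iInter fun _ ↦ ?_
      exact isClosed_eq (continuous_apply B) continuous_const
    · exact isClosed_iInter fun i ↦ isClosed_eq (by fun_prop) continuous_const
  have hcomp : IsCompact (stdSimplex ℝ (Finset α) ∩ K) := (isCompact_stdSimplex _ _).inter_right hK
  have hne : (stdSimplex ℝ (Finset α) ∩ K).Nonempty := by
    obtain ⟨c, c0, c1, c2, c3⟩ := exists_weights_of_mem_hypersimplex hk hkn h0 h1 hsum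
    exact ⟨c, ⟨c0, c1⟩, c2, c3⟩
  obtain ⟨c, ⟨⟨c0, c1⟩, c2, c3⟩, hmin⟩ := hcomp.exists_isMinOn hne
    (f := fun c ↦ ∑ H ∈ C, c H) (by fun_prop)
  refine ⟨c, c0, c1, fun B hB ↦ ?_, c3⟩
  by_contra hcB
  have hBk : #B = k := by
    by_contra h
    exact hcB (c2 B h)
  have hBC : B ∈ C := by
    by_contra h
    exact hB ⟨hBk, h⟩
  clear hB
  rename' B => H, hcB => hcH, hBk => hHk, hBC => hHC
  have hcHpos : 0 < c H := lt_of_le_of_ne (c0 H) (Ne.symm hcH)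
  -- Otherwise every set in the support other than `H` meets `H` in at least `k - 1` elements, and
  -- averaging gives `∑ i ∈ H, y i ≥ k - 1 + c H`.
  obtain ⟨B, hcB, hBH⟩ : ∃ B, 0 < c B ∧ #(H ∩ B) + 2 ≤ k := by
    by_contra! hcon
    have e1 : ∑ i ∈ H, y i = ∑ B, c B * #(H ∩ B) := by
      simp_rw [← c3]
      rw [sum_comm]
      refine sum_congr rfl fun B _ ↦ ?_
      rw [← mul_sum, sum_boole, filter_mem_eq_inter]
    have e2 : ∑ B, c B * ((k - 1 : ℝ) + if B = H then 1 else 0) ≤ ∑ B, c B * #(H ∩ B) := by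
      refine sum_le_sum fun B _ ↦ ?_
      rcases (c0 B).eq_or_lt with h | h
      · rw [← h, zero_mul, zero_mul]
      · refine mul_le_mul_of_nonneg_left ?_ h.le
        split_ifs with hB
        · rw [hB, inter_self, hHk]; linarith
        · have h2 : k < #(H ∩ B) + 2 := hcon B h
          have : (k : ℝ) ≤ #(H ∩ B) + 1 := by exact_mod_cast (by omega : k ≤ #(H ∩ B) + 1)
          linarith
    simp only [mul_add, sum_add_distrib, ← sum_mul, c1, mul_ite, mul_one, mul_zero,
      sum_ite_eq', mem_univ, if_true] at e2
    have := hH H hHC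
    linarith
  have hBk : #B = k := by
    by_contra h
    exact hcB.ne' (c2 B h)
  have hHB : H ≠ B := by
    rintro rfl
    rw [inter_self, hHk] at hBH
    omega
  have hd1 : #(H \ B) + #(H ∩ B) = k := by rw [card_sdiff_add_card_inter, hHk]
  have hd2 : #(B \ H) = #(H \ B) := card_sdiff_comm (hBk.trans hHk.symm)
  obtain ⟨e, he⟩ := card_pos.1 (show 0 < #(B \ H) by omega)
  rw [mem_sdiff] at he
  obtain ⟨g₁, g₂, hg₁, hg₂, hg⟩ := one_lt_card_iff.1 (show 1 < #(H \ B) by omega)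
  -- Two candidates for `h` are available and at most one of them leads into `C`. The partner `H - h
  -- + e` avoids `C` automatically, being one exchange away from `H`.
  obtain ⟨h, hhH, hhB, hB'C⟩ : ∃ h ∈ H, h ∉ B ∧ insert h (B.erase e) ∉ C := by
    rw [mem_sdiff] at hg₁ hg₂
    rcases hC.insert_notMem_or (A := B.erase e) (fun h ↦ hg₁.2 (mem_of_mem_erase h))
      (fun h ↦ hg₂.2 (mem_of_mem_erase h)) hg with h | h
    · exact ⟨g₁, hg₁.1, hg₁.2, h⟩
    · exact ⟨g₂, hg₂.1, hg₂.2, h⟩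
  have heh : e ≠ h := fun h' ↦ he.2 (h' ▸ hhH)
  set B' := insert h (B.erase e) with hB'
  set H' := insert e (H.erase h) with hH'
  have hH'C : H' ∉ C := by
    rcases hC.insert_notMem_or (A := H.erase h) (fun h ↦ he.2 (mem_of_mem_erase h))
      (notMem_erase h H) heh with h' | h'
    · exact h'
    · rw [insert_erase hhH] at h'
      exact absurd hHC h'
  have hB'k : #B' = k := by
    rw [hB', card_insert_of_notMem (fun h ↦ hhB (mem_of_mem_erase h)), card_erase_add_one he.1, hBk]
  have hH'k : #H' = k := by
    rw [hH', card_insert_of_notMem (fun h ↦ he.2 (mem_of_mem_erase h)), card_erase_add_one hhH, hHk]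
  have hind : ∀ i, (if i ∈ H then (1 : ℝ) else 0) + (if i ∈ B then 1 else 0) =
      (if i ∈ H' then 1 else 0) + (if i ∈ B' then 1 else 0) := by
    intro i
    by_cases hie : i = e
    · subst hie
      simp [hB', hH', he.1, he.2, heh]
    · by_cases hih : i = h
      · subst hih
        simp [hB', hH', hhH, hhB, hie]
      · simp [hB', hH', hie, hih]
  set ε := min (c H) (c B) with hε
  have hεpos : 0 < ε := lt_min hcHpos hcB
  let δ : Finset α → Finset α → ℝ := fun X Y ↦ if Y = X then 1 else 0
  let c' : Finset α → ℝ := fun X ↦ c X - ε * δ H X - ε * δ B X + ε * δ H' X + ε * δ B' X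
  have hδ : ∀ X Y, 0 ≤ δ X Y := fun X Y ↦ by simp only [δ]; split_ifs <;> norm_num
  have hc' : c' ∈ stdSimplex ℝ (Finset α) ∩ K := by
    refine ⟨⟨fun X ↦ ?_, ?_⟩, fun X hX ↦ ?_, fun i ↦ ?_⟩
    · have h3 : 0 ≤ c X - ε * δ H X - ε * δ B X := by
        simp only [δ]
        by_cases hXH : X = H
        · subst hXH
          simp [hHB, hε]
        · by_cases hXB : X = B
          · subst hXB
            simp [hXH, hε]
          · simpa [hXH, hXB] using c0 X
      have := mul_nonneg hεpos.le (hδ H' X)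
      have := mul_nonneg hεpos.le (hδ B' X)
      simp only [c']
      linarith
    · simp only [c', δ, sum_add_distrib, sum_sub_distrib, c1, ← mul_sum, sum_ite_eq', mem_univ,
        if_true]
      ring
    · have hne : ∀ Y : Finset α, #Y = k → X ≠ Y := fun Y hY h ↦ hX (h ▸ hY)
      simp [c', δ, c2 X hX, hne H hHk, hne B hBk, hne H' hH'k, hne B' hB'k]
    · have : ∑ X, c' X * (if i ∈ X then 1 else 0) = y i - ε * (if i ∈ H then 1 else 0)
          - ε * (if i ∈ B then 1 else 0) + ε * (if i ∈ H' then 1 else 0)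
          + ε * (if i ∈ B' then 1 else 0) := by
        rw [← c3 i]
        simp only [c', δ, add_mul, sub_mul, sum_add_distrib, sum_sub_distrib, mul_assoc, ← mul_sum,
          ite_mul, one_mul, zero_mul, sum_ite_eq', mem_univ, if_true]
      rw [this]
      linear_combination -ε * hind i
  have hlt : ∑ X ∈ C, c' X < ∑ X ∈ C, c X := by
    simp only [c', δ, sum_add_distrib, sum_sub_distrib, ← mul_sum, sum_ite_eq', hHC, hH'C, hB'C,
      if_true, if_false]
    split_ifs <;> linarith
  exact absurd (hmin hc') (not_le.2 hlt)

omit [Fintype α] in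
theorem card_inter_lt (hC : IsExchangeFree k C) {H F : Finset α} (hH : H ∈ C) (hF : #F = k)
    (hFC : F ∉ C) : #(H ∩ F) + 1 ≤ k := by
  by_contra! hcon
  have hHk := hC.card_eq H hH
  have h1 : H ∩ F = H := eq_of_subset_of_card_le inter_subset_left (by omega)
  have h2 : H = F := eq_of_subset_of_card_le (inter_eq_left.1 h1) (by omega)
  exact hFC (h2 ▸ hH)

theorem mem_basisPolytope_matroid_iff (hC : IsExchangeFree k C) (hk : 1 ≤ k)
    (hkn : k + 1 ≤ Fintype.card α) {y : α → ℝ} :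
    y ∈ basisPolytope (hC.matroid hk hkn) ↔ (∀ i, 0 ≤ y i) ∧ (∀ i, y i ≤ 1) ∧ ∑ i, y i = k ∧
      ∀ H ∈ C, ∑ i ∈ H, y i ≤ k - 1 := by
  constructor
  · let Q : Set (α → ℝ) := {y | (∀ i, 0 ≤ y i) ∧ (∀ i, y i ≤ 1) ∧ ∑ i, y i = k ∧
      ∀ H ∈ C, ∑ i ∈ H, y i ≤ k - 1}
    intro hy
    suffices h : basisPolytope (hC.matroid hk hkn) ⊆ Q from h hy
    refine convexHull_min ?_ ?_
    · rintro v ⟨_, ⟨F, rfl, hF, hFC⟩, rfl⟩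
      have hv : ∀ i, (F : Set α).indicator (fun _ ↦ (1 : ℝ)) i = if i ∈ F then 1 else 0 := by
        intro i
        simp [Set.indicator_apply]
      refine ⟨fun i ↦ ?_, fun i ↦ ?_, ?_, fun H hH ↦ ?_⟩
      · rw [hv]; split_ifs <;> norm_num
      · rw [hv]; split_ifs <;> norm_num
      · simp_rw [hv]
        rw [sum_boole, filter_mem_eq_inter, univ_inter, hF]
      · simp_rw [hv]
        rw [sum_boole, filter_mem_eq_inter, le_sub_iff_add_le]
        exact_mod_cast hC.card_inter_lt hH hF hFC
    · intro x hx z hz a b ha hb hab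
      obtain ⟨x0, x1, x2, x3⟩ := hx
      obtain ⟨z0, z1, z2, z3⟩ := hz
      refine ⟨fun i ↦ ?_, fun i ↦ ?_, ?_, fun H hH ↦ ?_⟩ <;>
        simp only [Pi.add_apply, Pi.smul_apply, smul_eq_mul, sum_add_distrib, ← mul_sum]
      · exact add_nonneg (mul_nonneg ha (x0 i)) (mul_nonneg hb (z0 i))
      · nlinarith [mul_le_mul_of_nonneg_left (x1 i) ha, mul_le_mul_of_nonneg_left (z1 i) hb]
      · rw [x2, z2, ← add_mul, hab, one_mul]
      · have := mul_le_mul_of_nonneg_left (x3 H hH) ha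
        have := mul_le_mul_of_nonneg_left (z3 H hH) hb
        have e : a * ((k : ℝ) - 1) + b * (k - 1) = k - 1 := by rw [← add_mul, hab, one_mul]
        linarith
  · rintro ⟨h0, h1, hsum, hH⟩
    obtain ⟨c, c0, c1, c2, c3⟩ := hC.exists_weights_of_sum_le hk hkn h0 h1 hsum hH
    have hzero : ∀ B ∈ (univ : Finset (Finset α)), B ∉ {B : Finset α | #B = k ∧ B ∉ C}.toFinset →
        c B = 0 := by
      intro B _ hB
      exact c2 B (by simpa using hB)
    have hy : y = ∑ B ∈ {B : Finset α | #B = k ∧ B ∉ C}.toFinset,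
        c B • (B : Set α).indicator (fun _ ↦ (1 : ℝ)) := by
      rw [sum_subset (subset_univ _) fun B hB hB' ↦ by rw [hzero B hB hB', zero_smul]]
      ext i
      rw [← c3 i, Finset.sum_apply]
      refine sum_congr rfl fun B _ ↦ ?_
      simp [Set.indicator_apply]
    rw [hy]
    refine (convex_convexHull ℝ _).sum_mem (fun B _ ↦ c0 B) ?_ fun B hB ↦ ?_
    · rw [sum_subset (subset_univ _) hzero, c1]
    · refine subset_convexHull ℝ _ ⟨B, ⟨B, rfl, ?_⟩, rfl⟩
      simpa using hB

theorem latticePoints_basisPolytope_matroid (hC : IsExchangeFree k C) (hk : 1 ≤ k)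
    (hkn : k + 1 ≤ Fintype.card α) (t : ℕ) :
    latticePoints (basisPolytope (hC.matroid hk hkn)) t =
      {x : α → ℤ | (∀ i, 0 ≤ x i) ∧ (∀ i, x i ≤ t) ∧ ∑ i, x i = k * t ∧
        ∀ H ∈ C, ∑ i ∈ H, x i ≤ (k - 1) * t} := by
  ext x
  constructor
  · rintro ⟨y, hy, hx⟩
    obtain ⟨h0, h1, h2, h3⟩ := (hC.mem_basisPolytope_matroid_iff hk hkn).1 hy
    have ht : (0 : ℝ) ≤ t := t.cast_nonneg
    refine ⟨fun i ↦ ?_, fun i ↦ ?_, ?_, fun H hH ↦ ?_⟩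
    · have := mul_nonneg ht (h0 i)
      rw [← hx] at this
      exact_mod_cast this
    · have := mul_le_mul_of_nonneg_left (h1 i) ht
      rw [← hx, mul_one] at this
      exact_mod_cast this
    · have : ∑ i, (x i : ℝ) = k * t := by
        simp_rw [hx]
        rw [← mul_sum, h2, mul_comm]
      exact_mod_cast this
    · have : ∑ i ∈ H, (x i : ℝ) ≤ (k - 1) * t := by
        simp_rw [hx]
        rw [← mul_sum, mul_comm]
        exact mul_le_mul_of_nonneg_right (h3 H hH) ht
      exact_mod_cast this
  · rintro ⟨h0, h1, h2, h3⟩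
    -- For `t = 0` division by `t` does not recover a point of the polytope, but only `x = 0` occurs
    -- and any vertex serves.
    rcases t.eq_zero_or_pos with rfl | ht
    · obtain ⟨B, hB, hBC⟩ := hC.exists_card_eq_notMem hk hkn
      refine ⟨_, subset_convexHull ℝ _ ⟨B, ⟨B, rfl, hB, hBC⟩, rfl⟩, fun i ↦ ?_⟩
      have : x i = 0 := le_antisymm (by simpa using h1 i) (h0 i)
      simp [this]
    · have ht' : (0 : ℝ) < t := by exact_mod_cast ht
      refine ⟨fun i ↦ x i / t, ?_, fun i ↦ by field_simp⟩
      rw [hC.mem_basisPolytope_matroid_iff hk hkn]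
      refine ⟨fun i ↦ ?_, fun i ↦ ?_, ?_, fun H hH ↦ ?_⟩
      · exact div_nonneg (by exact_mod_cast h0 i) ht'.le
      · rw [div_le_one ht']
        exact_mod_cast h1 i
      · rw [← sum_div, div_eq_iff ht'.ne']
        exact_mod_cast h2
      · rw [← sum_div, div_le_iff₀ ht']
        exact_mod_cast h3 H hH

end IsExchangeFree

/-! ### Counting lattice points -/

theorem card_piAntidiag_nat {α : Type*} [DecidableEq α] (s : Finset α) (m : ℕ) :
    #(piAntidiag s m) = (#s + m - 1).choose m := by
  rw [← card_finsuppAntidiag_nat_eq_choose]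
  refine card_bij' (fun f hf ↦ Finsupp.onFinset s f (mem_piAntidiag.1 hf).2) (fun f _ ↦ f) ?_ ?_
    (fun _ _ ↦ rfl) (fun _ _ ↦ Finsupp.ext fun _ ↦ rfl)
  · intro f hf
    rw [mem_finsuppAntidiag]
    exact ⟨(mem_piAntidiag.1 hf).1, Finsupp.support_onFinset_subset⟩
  · intro f hf
    rw [mem_finsuppAntidiag] at hf
    exact mem_piAntidiag.2 ⟨hf.1, fun i hi ↦ hf.2 (Finsupp.mem_support_iff.2 hi)⟩

section Counting

variable {α : Type*} [Fintype α] [DecidableEq α]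

/-- The integer points of the dilation by `t` of the hypersimplex of rank `k`. -/
def dilatedHypersimplex (α : Type*) [Fintype α] [DecidableEq α] (k t : ℕ) : Finset (α → ℕ) :=
  {x ∈ Fintype.piFinset fun _ : α ↦ range (t + 1) | ∑ i, x i = k * t}

theorem mem_dilatedHypersimplex {k t : ℕ} {x : α → ℕ} :
    x ∈ dilatedHypersimplex α k t ↔ (∀ i, x i ≤ t) ∧ ∑ i, x i = k * t := by
  simp [dilatedHypersimplex]

/-- Complementation of coordinates exchanges the ranks `k` and `n - k`. -/
theorem card_dilatedHypersimplex_compl {k l t : ℕ} (h : k + l = Fintype.card α) :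
    #(dilatedHypersimplex α k t) = #(dilatedHypersimplex α l t) := by
  have key : ∀ k l : ℕ, k + l = Fintype.card α → ∀ x ∈ dilatedHypersimplex α k t,
      (fun i ↦ t - x i) ∈ dilatedHypersimplex α l t := by
    intro k l h x hx
    rw [mem_dilatedHypersimplex] at hx ⊢
    refine ⟨fun i ↦ Nat.sub_le _ _, ?_⟩
    have : ∑ i, (t - x i) + ∑ i, x i = ∑ _i : α, t := by
      rw [← sum_add_distrib]
      exact sum_congr rfl fun i _ ↦ Nat.sub_add_cancel (hx.1 i)
    rw [hx.2, sum_const, card_univ, ← h, smul_eq_mul, add_mul] at this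
    omega
  refine card_bij' (fun x _ ↦ fun i ↦ t - x i) (fun x _ ↦ fun i ↦ t - x i) (key k l h)
    (key l k (by omega)) ?_ ?_ <;>
  · intro x hx
    ext i
    exact Nat.sub_sub_self ((mem_dilatedHypersimplex.1 hx).1 i)

/-- The number of integer points cut off from the dilated hypersimplex by a facet of a
circuit-hyperplane. -/
theorem card_filter_lt_sum {k l : ℕ} (h : k + l + 2 = Fintype.card α) {H : Finset α}
    (hH : #H = k + 1) (t : ℕ) :
    #{x ∈ dilatedHypersimplex α (k + 1) t | k * t < ∑ i ∈ H, x i} =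
      ∑ s ∈ range t, (s + k).choose k * (s + l).choose l := by
  have hHc : #Hᶜ = l + 1 := by
    rw [card_compl, hH, ← h]
    omega
  have hsplit : ∀ x : α → ℕ, ∑ i ∈ H, x i + ∑ i ∈ Hᶜ, x i = ∑ i, x i :=
    fun x ↦ sum_add_sum_compl H x
  rw [card_eq_sum_card_fiberwise (f := fun x : α → ℕ ↦ ∑ i ∈ Hᶜ, x i) (t := range t)]
  · refine sum_congr rfl fun s hs ↦ ?_
    rw [mem_range] at hs
    have hcard : #(piAntidiag H s ×ˢ piAntidiag Hᶜ s) = (s + k).choose k * (s + l).choose l := by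
      rw [card_product, card_piAntidiag_nat, card_piAntidiag_nat, hH, hHc]
      congr 1
      · rw [show k + 1 + s - 1 = s + k by omega, Nat.choose_symm_add]
      · rw [show l + 1 + s - 1 = s + l by omega, Nat.choose_symm_add]
    rw [← hcard]
    -- Passing to `t - x` on `H` makes both halves have sum `s`: the cut condition becomes `s < t`,
    -- and then the upper bounds `x i ≤ t` hold automatically. What remains is a pair of weak
    -- compositions of `s`.
    refine card_bij'
      (fun x _ ↦ (fun i ↦ if i ∈ H then t - x i else 0, fun i ↦ if i ∈ H then 0 else x i))
      (fun p _ ↦ fun i ↦ if i ∈ H then t - p.1 i else p.2 i) ?_ ?_ ?_ ?_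
    · intro x hx
      simp only [mem_filter, mem_dilatedHypersimplex] at hx
      obtain ⟨⟨⟨hxt, hxs⟩, -⟩, hxc⟩ := hx
      simp only [mem_product, mem_piAntidiag]
      refine ⟨⟨?_, fun i hi ↦ by_contra fun h ↦ hi (if_neg h)⟩, ⟨?_, fun i hi ↦ mem_compl.2
        fun h ↦ hi (if_pos h)⟩⟩
      · rw [sum_congr rfl fun i hi ↦ if_pos hi]
        have h1 : ∑ i ∈ H, (t - x i) + ∑ i ∈ H, x i = ∑ _i ∈ H, t := by
          rw [← sum_add_distrib]
          exact sum_congr rfl fun i _ ↦ Nat.sub_add_cancel (hxt i)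
        rw [sum_const, hH, smul_eq_mul] at h1
        have := hsplit x
        omega
      · rw [← hxc]
        exact sum_congr rfl fun i hi ↦ if_neg (mem_compl.1 hi)
    · rintro ⟨u, v⟩ hp
      simp only [mem_product, mem_piAntidiag] at hp
      obtain ⟨⟨hu, -⟩, hv, -⟩ := hp
      have hut : ∀ i ∈ H, u i ≤ t := fun i hi ↦
        ((single_le_sum (fun j _ ↦ Nat.zero_le (u j)) hi).trans hu.le).trans hs.le
      have hvt : ∀ i ∈ Hᶜ, v i ≤ t := fun i hi ↦
        ((single_le_sum (fun j _ ↦ Nat.zero_le (v j)) hi).trans hv.le).trans hs.le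
      have h1 : ∑ i ∈ H, (if i ∈ H then t - u i else v i) + s = (k + 1) * t := by
        rw [sum_congr rfl fun i hi ↦ if_pos hi, ← hu, ← sum_add_distrib,
          sum_congr rfl fun i hi ↦ Nat.sub_add_cancel (hut i hi), sum_const, hH, smul_eq_mul]
      have h2 : ∑ i ∈ Hᶜ, (if i ∈ H then t - u i else v i) = s := by
        rw [sum_congr rfl fun i hi ↦ if_neg (mem_compl.1 hi), hv]
      simp only [mem_filter, mem_dilatedHypersimplex]
      refine ⟨⟨⟨fun i ↦ ?_, ?_⟩, ?_⟩, h2⟩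
      · split_ifs with hi
        · exact Nat.sub_le _ _
        · exact hvt i (mem_compl.2 hi)
      · rw [← hsplit, h2, h1]
      · rw [add_mul, one_mul] at h1
        omega
    · intro x hx
      simp only [mem_filter, mem_dilatedHypersimplex] at hx
      ext i
      by_cases hi : i ∈ H
      · simp [hi, Nat.sub_sub_self (hx.1.1.1 i)]
      · simp [hi]
    · rintro ⟨u, v⟩ hp
      simp only [mem_product, mem_piAntidiag] at hp
      obtain ⟨⟨hu, hu'⟩, hv, hv'⟩ := hp
      have hut : ∀ i ∈ H, u i ≤ t := fun i hi ↦
        ((single_le_sum (fun j _ ↦ Nat.zero_le (u j)) hi).trans hu.le).trans hs.le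
      refine Prod.ext (funext fun i ↦ ?_) (funext fun i ↦ ?_)
      · by_cases hi : i ∈ H
        · simp [hi, Nat.sub_sub_self (hut i hi)]
        · simp only [hi, if_false]
          by_contra h
          exact hi (hu' i (Ne.symm h))
      · by_cases hi : i ∈ H
        · simp only [hi, if_true]
          by_contra h
          exact mem_compl.1 (hv' i (Ne.symm h)) hi
        · simp [hi]
  · intro x hx
    simp only [coe_filter, mem_dilatedHypersimplex, Set.mem_ofPred_eq] at hx
    have := hsplit x
    have h2 := hx.1.2
    rw [add_mul, one_mul] at h2
    simp only [coe_range, Set.mem_Iio]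
    omega

end Counting

namespace IsExchangeFree

variable {α : Type*} [Fintype α] [DecidableEq α] {C : Finset (Finset α)}

omit [Fintype α] in
theorem card_inter_add_two_le {k : ℕ} (hC : IsExchangeFree k C) {H H' : Finset α} (hH : H ∈ C)
    (hH' : H' ∈ C) (hne : H ≠ H') : #(H ∩ H') + 2 ≤ k := by
  have h1 := hC.card_eq H hH
  have h2 := hC.card_eq H' hH'
  have e1 := card_sdiff_add_card_inter H H'
  have e2 : #(H' \ H) = #(H \ H') := card_sdiff_comm (h2.trans h1.symm)
  by_contra! hcon
  have hpos : #(H \ H') ≠ 0 := by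
    intro h
    rw [card_eq_zero, sdiff_eq_empty_iff_subset] at h
    exact hne (eq_of_subset_of_card_le h (by omega))
  obtain ⟨a, ha⟩ := card_eq_one.1 (show #(H \ H') = 1 by omega)
  obtain ⟨b, hb⟩ := card_eq_one.1 (show #(H' \ H) = 1 by omega)
  have haH : a ∈ H \ H' := ha ▸ mem_singleton_self a
  have hbH : b ∈ H' \ H := hb ▸ mem_singleton_self b
  rw [mem_sdiff] at haH hbH
  have i1 : insert a (H ∩ H') = H := by
    rw [insert_eq, ← ha, sdiff_union_inter]
  have i2 : insert b (H ∩ H') = H' := by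
    rw [insert_eq, ← hb, inter_comm, sdiff_union_inter]
  have := hC.eq_of_insert (H ∩ H') a b (fun h ↦ haH.2 (mem_inter.1 h).2)
    (fun h ↦ hbH.2 (mem_inter.1 h).1) (i1.symm ▸ hH) (i2.symm ▸ hH')
  exact hbH.2 (this ▸ haH.1)

theorem latticePoints_finite_and_ncard {k l : ℕ} (hC : IsExchangeFree (k + 1) C)
    (h : k + l + 2 = Fintype.card α) (t : ℕ) :
    (latticePoints (basisPolytope (hC.matroid (by omega) (by omega))) t).Finite ∧
      (latticePoints (basisPolytope (hC.matroid (by omega) (by omega))) t).ncard +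
        #C * ∑ s ∈ range t, (s + k).choose k * (s + l).choose l =
      #(dilatedHypersimplex α (k + 1) t) := by
  set D := dilatedHypersimplex α (k + 1) t with hD
  let G : Finset (α → ℕ) := {x ∈ D | ∀ H ∈ C, ¬ k * t < ∑ i ∈ H, x i}
  have hL : latticePoints (basisPolytope (hC.matroid (by omega) (by omega))) t =
      (fun (x : α → ℕ) i ↦ (x i : ℤ)) '' (G : Set (α → ℕ)) := by
    rw [latticePoints_basisPolytope_matroid]
    ext x
    simp only [Set.mem_ofPred_eq, Set.mem_image, mem_coe, G, mem_filter, hD,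
      mem_dilatedHypersimplex, not_lt]
    constructor
    · rintro ⟨h0, h1, h2, h3⟩
      lift x to α → ℕ using h0
      dsimp only at h1 h2 h3
      refine ⟨x, ⟨⟨fun i ↦ by exact_mod_cast h1 i, by exact_mod_cast h2⟩, fun H hH ↦ ?_⟩, rfl⟩
      have := h3 H hH
      push_cast at this
      rw [add_sub_cancel_right] at this
      exact_mod_cast this
    · rintro ⟨x, ⟨⟨h1, h2⟩, h3⟩, rfl⟩
      dsimp only
      refine ⟨fun i ↦ Int.natCast_nonneg _, fun i ↦ by exact_mod_cast h1 i, by exact_mod_cast h2,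
        fun H hH ↦ ?_⟩
      push_cast
      rw [add_sub_cancel_right]
      exact_mod_cast h3 H hH
  have hinj : Function.Injective (fun (x : α → ℕ) i ↦ (x i : ℤ)) := by
    intro x y hxy
    ext i
    have := congrFun hxy i
    dsimp only at this
    exact_mod_cast this
  rw [hL]
  refine ⟨G.finite_toSet.image _, ?_⟩
  rw [Set.ncard_image_of_injective _ hinj, Set.ncard_coe_finset]
  have hcut : #C * ∑ s ∈ range t, (s + k).choose k * (s + l).choose l =
      #(C.biUnion fun H ↦ {x ∈ D | k * t < ∑ i ∈ H, x i}) := by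
    rw [card_biUnion]
    · rw [sum_congr rfl fun H hH ↦ card_filter_lt_sum h (hC.card_eq H hH) t, sum_const, smul_eq_mul]
    · intro H hH H' hH' hne
      -- A common point would have sums over `H` and `H'` totalling more than `2kt`. The total over
      -- union and intersection is at most `(k + 1)t + (k - 1)t`.
      rw [Function.onFun, disjoint_left]
      intro x hx hx'
      simp only [mem_filter, hD, mem_dilatedHypersimplex] at hx hx'
      have h1 : ∑ i ∈ H ∪ H', x i ≤ ∑ i, x i := sum_le_sum_of_subset (subset_univ _)
      have h2 : ∑ i ∈ H ∩ H', x i ≤ #(H ∩ H') * t := by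
        rw [← smul_eq_mul]
        exact sum_le_card_nsmul _ _ _ fun i _ ↦ hx.1.1 i
      have h3 := sum_union_inter (s₁ := H) (s₂ := H') (f := x)
      have h4 := hC.card_inter_add_two_le hH hH' hne
      have h5 : (#(H ∩ H') + 1) * t ≤ k * t := Nat.mul_le_mul_right t (by omega)
      have h6 := hx.1.2
      rw [add_mul, one_mul] at h5 h6
      have := hx.2
      have := hx'.2
      omega
  have hcompl : (C.biUnion fun H ↦ {x ∈ D | k * t < ∑ i ∈ H, x i}) =
      {x ∈ D | ¬ ∀ H ∈ C, ¬ k * t < ∑ i ∈ H, x i} := by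
    ext x
    simp only [mem_biUnion, mem_filter]
    push Not
    tauto
  rw [hcut, hcompl, card_filter_add_card_filter_not]

end IsExchangeFree

/-- The number of integer points of a dilated hypersimplex, by inclusion and exclusion. -/
theorem card_dilatedHypersimplex_eq_sum {α : Type*} [Fintype α] [DecidableEq α] {d : ℕ}
    (hd : Fintype.card α = d + 1) (k t : ℕ) :
    (#(dilatedHypersimplex α k t) : ℚ) = ∑ j ∈ range (d + 2), (-1) ^ j * ((d + 1).choose j : ℚ) *
      if j * (t + 1) ≤ k * t then ((d + (k * t - j * (t + 1))).choose d : ℚ) else 0 := by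
  open PowerSeries in
  -- The generating function `(1 + X + ⋯ + X ^ t) ^ (d + 1)` is expanded as `(1 - X ^ (t + 1)) ^ (d
  -- + 1)` times `(1 - X) ^ (-(d + 1))`.
  have h1 : (∑ i ∈ range (t + 1), (X : ℚ⟦X⟧) ^ i) ^ (d + 1) =
      ∑ p ∈ Fintype.piFinset (fun _ : α ↦ range (t + 1)), X ^ (∑ i, p i) := by
    rw [← hd, ← card_univ, ← prod_const, prod_univ_sum]
    exact sum_congr rfl fun p _ ↦ prod_pow_eq_pow_sum _ _ _
  have h2 : (∑ i ∈ range (t + 1), (X : ℚ⟦X⟧) ^ i) ^ (d + 1) =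
      ∑ j ∈ range (d + 2), C ((-1) ^ j * ((d + 1).choose j : ℚ)) *
        (X ^ (j * (t + 1)) * PowerSeries.mk fun m ↦ ((d + m).choose d : ℚ)) := by
    have h3 := mk_add_choose_mul_one_sub_pow_eq_one ℚ d
    calc _ = (∑ i ∈ range (t + 1), (X : ℚ⟦X⟧) ^ i) ^ (d + 1) *
          ((PowerSeries.mk fun m ↦ ((d + m).choose d : ℚ)) * (1 - X) ^ (d + 1)) := by rw [h3, mul_one]
      _ = (-X ^ (t + 1) + 1) ^ (d + 1) * PowerSeries.mk fun m ↦ ((d + m).choose d : ℚ) := by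
        rw [mul_comm (PowerSeries.mk _), ← mul_assoc, ← mul_pow, geom_sum_mul_neg, neg_add_eq_sub]
      _ = _ := by
        rw [add_pow, sum_mul]
        refine sum_congr rfl fun j _ ↦ ?_
        rw [one_pow, mul_one, neg_pow, ← pow_mul, mul_comm (t + 1) j]
        simp only [map_mul, map_pow, map_neg, map_one, map_natCast]
        ring
  have h4 := congrArg (PowerSeries.coeff (k * t)) (h1.symm.trans h2)
  simp only [map_sum, PowerSeries.coeff_X_pow, PowerSeries.coeff_C_mul,
    PowerSeries.coeff_X_pow_mul', PowerSeries.coeff_mk] at h4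
  rw [← h4, sum_boole, dilatedHypersimplex]
  congr 2
  exact filter_congr fun x _ ↦ eq_comm

/-! ### Ehrhart polynomials and their quadratic coefficients -/

open Polynomial

/-- The polynomial `∏ (1 + c X / (i + 1))` over `i < e`. -/
noncomputable def risingPoly (c : ℚ) (e : ℕ) : ℚ[X] :=
  ∏ i ∈ range e, (1 + C (c / (i + 1)) * X)

/-- The second elementary symmetric function of `1, 1/2, …, 1/e`. -/
def harmonicTwo (e : ℕ) : ℚ := ∑ i ∈ range e, harmonic i / (i + 1)

theorem harmonic_succ' (e : ℕ) : harmonic (e + 1) = harmonic e + 1 / (e + 1) := by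
  rw [harmonic_succ]
  push_cast
  rw [one_div]

theorem harmonicTwo_succ (e : ℕ) : harmonicTwo (e + 1) = harmonicTwo e + harmonic e / (e + 1) :=
  sum_range_succ _ _

theorem coeff_two_mul (p q : ℚ[X]) :
    (p * q).coeff 2 = p.coeff 0 * q.coeff 2 + p.coeff 1 * q.coeff 1 + p.coeff 2 * q.coeff 0 := by
  rw [coeff_mul, Nat.sum_antidiagonal_eq_sum_range_succ (f := fun i j ↦ p.coeff i * q.coeff j)]
  simp [sum_range_succ]

theorem risingPoly_coeff (c : ℚ) (e : ℕ) : (risingPoly c e).coeff 0 = 1 ∧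
    (risingPoly c e).coeff 1 = c * harmonic e ∧
    (risingPoly c e).coeff 2 = c ^ 2 * harmonicTwo e := by
  induction e with
  | zero => simp [risingPoly, harmonicTwo, coeff_one]
  | succ e ih =>
    obtain ⟨h0, h1, h2⟩ := ih
    have hs : risingPoly c (e + 1) = risingPoly c e * (1 + C (c / (e + 1)) * X) :=
      prod_range_succ _ _
    have e0 : (1 + C (c / (e + 1)) * X : ℚ[X]).coeff 0 = 1 := by simp
    have e1 : (1 + C (c / (e + 1)) * X : ℚ[X]).coeff 1 = c / (e + 1) := by simp [coeff_one]
    have e2 : (1 + C (c / (e + 1)) * X : ℚ[X]).coeff 2 = 0 := by simp [coeff_one]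
    rw [hs]
    refine ⟨by rw [mul_coeff_zero, h0, e0, mul_one], ?_, ?_⟩
    · rw [mul_coeff_one, h0, h1, e0, e1, harmonic_succ']
      ring
    · rw [coeff_two_mul, h0, h1, h2, e0, e1, e2, harmonicTwo_succ]
      ring

theorem prod_range_mul_X_add (c : ℚ) (e : ℕ) :
    ∏ i ∈ range e, (C c * X + C ((i : ℚ) + 1)) = C (e.factorial : ℚ) * risingPoly c e := by
  induction e with
  | zero => simp [risingPoly]
  | succ e ih =>
    have : (C c * X + C ((e : ℚ) + 1) : ℚ[X]) = C ((e : ℚ) + 1) * (1 + C (c / (e + 1)) * X) := by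
      rw [mul_add, ← mul_assoc, ← C_mul, mul_div_cancel₀ _ (by positivity)]
      ring
    rw [prod_range_succ, ih, this, risingPoly, risingPoly, prod_range_succ, Nat.factorial_succ]
    push_cast
    simp only [C_mul, C_add]
    ring

theorem prod_range_mul_X_sub (c : ℚ) (e : ℕ) :
    ∏ i ∈ range e, (C c * X + C ((i : ℚ) - e)) =
      C ((-1) ^ e * e.factorial : ℚ) * risingPoly (-c) e := by
  rw [← prod_range_reflect, C_mul, mul_assoc, ← prod_range_mul_X_add, C_pow]
  rw [← card_range e, ← prod_const, card_range, ← prod_mul_distrib]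
  refine prod_congr rfl fun i hi ↦ ?_
  rw [mem_range] at hi
  have : ((e - 1 - i : ℕ) : ℚ) - e = -1 * ((i : ℚ) + 1) := by
    rw [Nat.cast_sub (by omega), Nat.cast_sub (by omega)]
    push_cast
    ring
  rw [this]
  simp only [C_mul, C_neg, C_add, C_1]
  ring

/-- The polynomial in `t` equal to the binomial coefficient of `c t - j + d` over `d`. -/
noncomputable def choosePoly (d : ℕ) (c : ℚ) (j : ℕ) : ℚ[X] :=
  C (1 / (d.factorial : ℚ)) * ∏ i ∈ range d, (C c * X + C ((i : ℚ) + 1 - j))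

theorem choosePoly_coeff_two_zero (d : ℕ) (c : ℚ) :
    (choosePoly d c 0).coeff 2 = c ^ 2 * harmonicTwo d := by
  have : (d.factorial : ℚ) ≠ 0 := by exact_mod_cast d.factorial_ne_zero
  rw [choosePoly]
  simp only [Nat.cast_zero, sub_zero]
  rw [prod_range_mul_X_add, ← mul_assoc, ← C_mul, coeff_C_mul, (risingPoly_coeff c d).2.2]
  field_simp

/-- The factor with `i = a` is `c X`, so only a linear coefficient of the rest is needed. The
factors before it have negative constant terms and those after it positive ones, whence the
difference of harmonic numbers. -/
theorem choosePoly_coeff_two_succ (a e : ℕ) (c : ℚ) :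
    (choosePoly (a + 1 + e) c (a + 1)).coeff 2 = (-1) ^ a * (a.factorial * e.factorial) /
      (a + 1 + e).factorial * (c ^ 2 * (harmonic e - harmonic a)) := by
  have hp : ∏ i ∈ range (a + 1 + e), (C c * X + C ((i : ℚ) + 1 - (a + 1 : ℕ))) =
      C ((-1) ^ a * a.factorial * c * e.factorial : ℚ) *
        (X * (risingPoly (-c) a * risingPoly c e)) := by
    rw [prod_range_add, prod_range_succ]
    have h1 : ∏ i ∈ range a, (C c * X + C ((i : ℚ) + 1 - (a + 1 : ℕ))) =
        ∏ i ∈ range a, (C c * X + C ((i : ℚ) - a)) :=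
      prod_congr rfl fun i _ ↦ by push_cast; rw [add_sub_add_right_eq_sub]
    have h2 : ∏ i ∈ range e, (C c * X + C (((a + 1 + i : ℕ) : ℚ) + 1 - (a + 1 : ℕ))) =
        ∏ i ∈ range e, (C c * X + C ((i : ℚ) + 1)) :=
      prod_congr rfl fun i _ ↦ by push_cast; congr 2; ring
    have h3 : ((a : ℚ) + 1 - (a + 1 : ℕ)) = 0 := by push_cast; ring
    rw [h1, h2, h3, prod_range_mul_X_sub, prod_range_mul_X_add]
    simp only [C_mul, C_0, add_zero]
    ring
  rw [choosePoly, hp, ← mul_assoc, ← C_mul, coeff_C_mul, coeff_X_mul, mul_coeff_one]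
  obtain ⟨h0, h1, -⟩ := risingPoly_coeff (-c) a
  obtain ⟨h0', h1', -⟩ := risingPoly_coeff c e
  rw [h0, h1, h0', h1']
  ring

theorem choosePoly_eval {d k j t : ℕ} (hj : j < k) (hk : k ≤ d + 1) :
    (choosePoly d ((k : ℚ) - j) j).eval (t : ℚ) =
      if j * (t + 1) ≤ k * t then ((d + (k * t - j * (t + 1))).choose d : ℚ) else 0 := by
  rw [choosePoly, eval_mul, eval_C, eval_prod]
  simp only [eval_add, eval_mul, eval_C, eval_X]
  split_ifs with h
  · have h1 : ∀ i ∈ range d, ((k : ℚ) - j) * t + (i + 1 - j) =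
        ((k * t - j * (t + 1) + 1 + i : ℕ) : ℚ) := by
      intro i _
      push_cast [Nat.cast_sub h]
      ring
    rw [prod_congr rfl h1, ← Nat.cast_prod, ← Nat.ascFactorial_eq_prod_range,
      Nat.ascFactorial_eq_factorial_mul_choose, Nat.cast_mul, add_comm (k * t - _) d]
    have : (d.factorial : ℚ) ≠ 0 := by exact_mod_cast d.factorial_ne_zero
    field_simp
  · push Not at h
    have h2 : j * t ≤ k * t := Nat.mul_le_mul_right t hj.le
    have h3 : j * (t + 1) = j * t + j := by ring
    -- Where the count is zero by convention, the polynomial vanishes too: this index gives a zero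
    -- factor, and it is below `d` because `j < k ≤ d + 1`.
    rw [prod_eq_zero (i := j * (t + 1) - k * t - 1) (mem_range.2 (by omega)), mul_zero]
    have h4 : ((j * (t + 1) - k * t - 1 : ℕ) : ℚ) + 1 = j * (t + 1) - k * t := by
      have : j * (t + 1) - k * t - 1 + 1 + k * t = j * (t + 1) := by omega
      have : (((j * (t + 1) - k * t - 1 + 1 + k * t : ℕ)) : ℚ) = ((j * (t + 1) : ℕ) : ℚ) := by
        rw [this]
      push_cast at this ⊢
      linarith
    rw [h4]
    ring

/-- The Ehrhart polynomial of the hypersimplex of rank `k` on `d + 1` elements. -/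
noncomputable def hypersimplexPoly (d k : ℕ) : ℚ[X] :=
  ∑ j ∈ range k, C ((-1) ^ j * ((d + 1).choose j : ℚ)) * choosePoly d ((k : ℚ) - j) j

theorem hypersimplexPoly_eval {α : Type*} [Fintype α] [DecidableEq α] {d k : ℕ}
    (hd : Fintype.card α = d + 1) (hk0 : 0 < k) (hk : k ≤ d + 1) (t : ℕ) :
    (hypersimplexPoly d k).eval (t : ℚ) = #(dilatedHypersimplex α k t) := by
  rw [card_dilatedHypersimplex_eq_sum hd, hypersimplexPoly, eval_finsetSum]
  rw [← sum_subset (range_mono (show k ≤ d + 2 by omega))]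
  · refine sum_congr rfl fun j hj ↦ ?_
    rw [eval_mul, eval_C, choosePoly_eval (mem_range.1 hj) hk]
  · intro j _ hj
    rw [mem_range, not_lt] at hj
    rw [if_neg, mul_zero]
    have : k * t + k ≤ j * (t + 1) := by
      rw [← Nat.mul_succ]
      exact Nat.mul_le_mul_right _ hj
    omega

/-- The sign of inclusion and exclusion cancels the sign in `choosePoly_coeff_two_succ`, so every
term after the first is subtracted. -/
theorem hypersimplexPoly_coeff_two {a b : ℕ} :
    (hypersimplexPoly (a + b + 1) (a + 1)).coeff 2 = (a + 1) ^ 2 * harmonicTwo (a + b + 1) -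
      ∑ j ∈ range a, ((a : ℚ) - j) ^ 2 * (a + b + 2) / ((j + 1) * (a + b + 1 - j)) *
        (harmonic (a + b - j) - harmonic j) := by
  rw [hypersimplexPoly, finsetSum_coeff, sum_range_succ']
  simp only [coeff_C_mul]
  rw [Nat.cast_zero, sub_zero, choosePoly_coeff_two_zero, add_comm, sub_eq_add_neg,
    ← sum_neg_distrib]
  congr 1
  · simp
  · refine sum_congr rfl fun j hj ↦ ?_
    rw [mem_range] at hj
    obtain ⟨e, he⟩ : ∃ e, a + b = j + e := ⟨a + b - j, by omega⟩
    have hab : (a : ℚ) + b = j + e := by exact_mod_cast he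
    rw [show a + b + 1 = j + 1 + e by omega, choosePoly_coeff_two_succ,
      show a + b - j = e by omega, hab]
    have hc : ((j + 1 + e + 1).choose (j + 1) : ℚ) =
        (j + 1 + e + 1).factorial / ((j + 1).factorial * (e + 1).factorial) := by
      rw [Nat.cast_choose ℚ (by omega), show j + 1 + e + 1 - (j + 1) = e + 1 by omega]
    have f1 : (j.factorial : ℚ) ≠ 0 := by exact_mod_cast j.factorial_ne_zero
    have f2 : (e.factorial : ℚ) ≠ 0 := by exact_mod_cast e.factorial_ne_zero
    have f3 : ((j + 1 + e).factorial : ℚ) ≠ 0 := by exact_mod_cast (j + 1 + e).factorial_ne_zero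
    have f4 : (j : ℚ) + 1 ≠ 0 := by positivity
    have f5 : (e : ℚ) + 1 ≠ 0 := by positivity
    have hs : ((-1 : ℚ)) ^ (j + 1) * (-1) ^ j = -1 := by
      rw [pow_succ, mul_right_comm, ← mul_pow]
      norm_num
    have e3 : (j : ℚ) + e + 1 - j = e + 1 := by ring
    rw [hc, Nat.factorial_succ, Nat.factorial_succ, Nat.factorial_succ, e3]
    push_cast
    rw [add_sub_add_right_eq_sub]
    calc _ = ((-1 : ℚ) ^ (j + 1) * (-1) ^ j) * ((((j : ℚ) + 1 + e + 1) * (j + 1 + e).factorial) /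
          (((j : ℚ) + 1) * j.factorial * ((e + 1) * e.factorial)) * ((j.factorial * e.factorial) /
            (j + 1 + e).factorial * (((a : ℚ) - j) ^ 2 * (harmonic e - harmonic j)))) := by ring
      _ = _ := by
        rw [hs]
        field_simp
        ring

/-- The polynomial in `t` equal to the binomial coefficient of `t + m - 1` over `m`. -/
noncomputable def multichoosePoly (m : ℕ) : ℚ[X] :=
  C (1 / (m.factorial : ℚ)) * ∏ i ∈ range m, (X + C (i : ℚ))

theorem multichoosePoly_eval_succ (m : ℕ) (x : ℚ) :
    (multichoosePoly (m + 1)).eval x = (multichoosePoly m).eval x * (x + m) / (m + 1) := by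
  have f1 : (m.factorial : ℚ) ≠ 0 := by exact_mod_cast m.factorial_ne_zero
  simp only [multichoosePoly, prod_range_succ, Nat.factorial_succ, eval_mul, eval_C, eval_add,
    eval_X]
  push_cast
  field_simp

theorem multichoosePoly_eval_succ' (m : ℕ) (x : ℚ) :
    (multichoosePoly (m + 1)).eval x = (multichoosePoly m).eval (x + 1) * x / (m + 1) := by
  induction m with
  | zero => simp [multichoosePoly]
  | succ m ih =>
    rw [multichoosePoly_eval_succ, ih, multichoosePoly_eval_succ]
    push_cast
    field_simp
    ring

theorem multichoosePoly_eval_natCast_add_one (m s : ℕ) :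
    (multichoosePoly m).eval ((s : ℚ) + 1) = (s + m).choose m := by
  have f1 : (m.factorial : ℚ) ≠ 0 := by exact_mod_cast m.factorial_ne_zero
  rw [multichoosePoly, eval_mul, eval_C, eval_prod]
  simp only [eval_add, eval_X, eval_C]
  have : ∏ i ∈ range m, ((s : ℚ) + 1 + i) = ((s + 1).ascFactorial m : ℕ) := by
    rw [Nat.ascFactorial_eq_prod_range]
    push_cast
    rfl
  rw [this, Nat.ascFactorial_eq_factorial_mul_choose]
  push_cast
  field_simp

theorem multichoosePoly_zero : multichoosePoly 0 = 1 := by simp [multichoosePoly]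

theorem multichoosePoly_succ (m : ℕ) :
    multichoosePoly (m + 1) = C (1 / ((m : ℚ) + 1)) * (X * risingPoly 1 m) := by
  have f1 : (m.factorial : ℚ) ≠ 0 := by exact_mod_cast m.factorial_ne_zero
  have f2 : (m : ℚ) + 1 ≠ 0 := by positivity
  have h := prod_range_mul_X_add 1 m
  rw [C_1] at h
  simp only [one_mul] at h
  have h2 : ∏ i ∈ range m, (X + C (((i + 1 : ℕ)) : ℚ)) = C (m.factorial : ℚ) * risingPoly 1 m := by
    rw [← h]
    exact prod_congr rfl fun i _ ↦ by push_cast; rfl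
  rw [multichoosePoly, prod_range_succ', h2, Nat.factorial_succ]
  have h3 : (1 / (((m + 1) * m.factorial : ℕ) : ℚ)) * m.factorial = 1 / ((m : ℚ) + 1) := by
    push_cast
    field_simp
  rw [← h3, C_mul]
  simp only [Nat.cast_zero, C_0, add_zero]
  ring

/-- This closed form turns a sum with `t` terms into a polynomial in `t` with the visible factor
`multichoosePoly (b + 1)`, which is divisible by `X`. -/
theorem multichoosePoly_sum (a b t : ℕ) :
    (multichoosePoly a).eval ((b : ℚ) + 1 + 1) *
      ∑ s ∈ range t, (multichoosePoly a).eval ((s : ℚ) + 1) * (multichoosePoly b).eval ((s : ℚ) + 1) =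
    (multichoosePoly (b + 1)).eval (t : ℚ) * ∑ j ∈ range (a + 1),
      (multichoosePoly j).eval ((b : ℚ) + 1) * (multichoosePoly j).eval (t : ℚ) := by
  induction a with
  | zero =>
    simp only [multichoosePoly_zero, eval_one, one_mul, zero_add, sum_range_one, mul_one]
    induction t with
    | zero => simp [multichoosePoly_eval_succ']
    | succ t ih =>
      rw [sum_range_succ, ih, multichoosePoly_eval_succ' b t, Nat.cast_succ,
        multichoosePoly_eval_succ b]
      field_simp
      ring
  | succ a ih =>
    -- Only the difference between the cases `a + 1` and `a` remains; it is checked by induction on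
    -- `t`.
    rw [sum_range_succ, mul_add, ← ih]
    clear ih
    induction t with
    | zero => simp [multichoosePoly_eval_succ']
    | succ t ih =>
      rw [sum_range_succ, sum_range_succ, mul_add, mul_add, ih, Nat.cast_succ]
      rw [multichoosePoly_eval_succ a ((b : ℚ) + 1 + 1), multichoosePoly_eval_succ a ((t : ℚ) + 1),
        multichoosePoly_eval_succ' a ((b : ℚ) + 1), multichoosePoly_eval_succ b ((t : ℚ) + 1),
        multichoosePoly_eval_succ' b (t : ℚ), multichoosePoly_eval_succ' a (t : ℚ)]
      field_simp
      ring

/-- The polynomial counting the integer points cut off by a facet of a circuit-hyperplane. -/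
noncomputable def cutPoly (a b : ℕ) : ℚ[X] :=
  C (1 / ((a + b + 1).choose a : ℚ)) * (multichoosePoly (b + 1) *
    ∑ j ∈ range (a + 1), C ((b + j).choose j : ℚ) * multichoosePoly j)

theorem cutPoly_eval (a b t : ℕ) : (cutPoly a b).eval (t : ℚ) =
    ((∑ s ∈ range t, (s + a).choose a * (s + b).choose b : ℕ) : ℚ) := by
  have h := multichoosePoly_sum a b t
  have h1 : ((b : ℚ) + 1 + 1) = ((b + 1 : ℕ) : ℚ) + 1 := by push_cast; rfl
  rw [h1] at h
  simp only [multichoosePoly_eval_natCast_add_one] at h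
  have h2 : ((a + b + 1).choose a : ℚ) ≠ 0 := by
    exact_mod_cast (Nat.choose_pos (by omega)).ne'
  simp only [cutPoly, eval_mul, eval_C, eval_finsetSum]
  rw [← h, show b + 1 + a = a + b + 1 by omega]
  push_cast
  field_simp

theorem cutPoly_coeff_two (a b : ℕ) : (cutPoly a b).coeff 2 =
    1 / (((a + b + 1).choose a : ℚ) * (b + 1)) *
      (harmonic b + ∑ j ∈ range a, ((b + j + 1).choose (j + 1) : ℚ) / (j + 1)) := by
  have h0 : (multichoosePoly (b + 1)).coeff 0 = 0 := by simp [multichoosePoly_succ]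
  have h1 : ∀ m, (multichoosePoly (m + 1)).coeff 1 = 1 / ((m : ℚ) + 1) := by
    intro m
    rw [multichoosePoly_succ, coeff_C_mul, coeff_X_mul, (risingPoly_coeff 1 m).1, mul_one]
  have h2 : (multichoosePoly (b + 1)).coeff 2 = harmonic b / (b + 1) := by
    rw [multichoosePoly_succ, coeff_C_mul, coeff_X_mul, (risingPoly_coeff 1 b).2.1]
    ring
  have h3 : (∑ j ∈ range (a + 1), C ((b + j).choose j : ℚ) * multichoosePoly j).coeff 0 = 1 := by
    rw [finsetSum_coeff, sum_range_succ', sum_eq_zero fun j _ ↦ by simp [multichoosePoly_succ]]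
    simp [multichoosePoly_zero]
  have h4 : (∑ j ∈ range (a + 1), C ((b + j).choose j : ℚ) * multichoosePoly j).coeff 1 =
      ∑ j ∈ range a, ((b + j + 1).choose (j + 1) : ℚ) / (j + 1) := by
    rw [finsetSum_coeff, sum_range_succ']
    simp only [coeff_C_mul, h1, multichoosePoly_zero, coeff_one, one_ne_zero, if_false, mul_zero,
      add_zero]
    exact sum_congr rfl fun j _ ↦ by rw [← add_assoc]; ring
  have h5 : ((a + b + 1).choose a : ℚ) ≠ 0 := by
    exact_mod_cast (Nat.choose_pos (by omega)).ne'
  rw [cutPoly, coeff_C_mul, coeff_two_mul, h0, h1, h2, h3, h4]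
  field_simp
  ring

/-! ### Numerical bounds for harmonic sums -/

section Harmonic

theorem harmonic_mono' : Monotone harmonic := fun m n h ↦
  sum_le_sum_of_subset_of_nonneg (range_mono h) fun i _ _ ↦ by positivity

theorem harmonic_nonneg (m : ℕ) : 0 ≤ harmonic m := harmonic_mono' (Nat.zero_le m)

theorem two_mul_harmonicTwo (m : ℕ) :
    2 * harmonicTwo m = harmonic m ^ 2 - ∑ i ∈ range m, 1 / ((i : ℚ) + 1) ^ 2 := by
  induction m with
  | zero => simp [harmonicTwo]
  | succ m ih =>
    rw [harmonicTwo_succ, mul_add, ih, harmonic_succ', sum_range_succ]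
    field_simp
    ring

theorem harmonicTwo_le (m : ℕ) : harmonicTwo m ≤ harmonic m ^ 2 / 2 := by
  have h1 := two_mul_harmonicTwo m
  have h2 : 0 ≤ ∑ i ∈ range m, 1 / ((i : ℚ) + 1) ^ 2 := sum_nonneg fun i _ ↦ by positivity
  linarith

/-- Fixed-point arithmetic at scale `S`, each term rounded up, reduces the bound to a computation
with natural numbers. -/
theorem harmonic_le_of_sum_le {m S c : ℕ} (hS : 0 < S)
    (h : ∑ i ∈ range m, (S / (i + 1) + 1) ≤ c) : harmonic m ≤ (c : ℚ) / S := by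
  have hS' : (0 : ℚ) < S := by exact_mod_cast hS
  rw [le_div_iff₀ hS', harmonic, sum_mul]
  refine le_trans ?_ (Nat.cast_le.2 h)
  push_cast
  refine sum_le_sum fun i _ ↦ ?_
  have h1 : S < (S / (i + 1) + 1) * (i + 1) := by
    rw [add_one_mul]
    exact Nat.lt_div_mul_add i.succ_pos
  have h2 : (S : ℚ) < ((S / (i + 1) : ℕ) + 1) * (i + 1) := by exact_mod_cast h1
  rw [inv_mul_eq_div, div_le_iff₀ (by positivity)]
  exact h2.le

theorem le_sum_one_div_sq {m S c : ℕ} (hS : 0 < S)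
    (h : c ≤ ∑ i ∈ range m, S / (i + 1) ^ 2) :
    (c : ℚ) / S ≤ ∑ i ∈ range m, 1 / ((i : ℚ) + 1) ^ 2 := by
  have hS' : (0 : ℚ) < S := by exact_mod_cast hS
  rw [div_le_iff₀ hS', sum_mul]
  refine (Nat.cast_le.2 h).trans ?_
  push_cast
  refine sum_le_sum fun i _ ↦ ?_
  rw [one_div_mul_eq_div]
  refine Nat.cast_div_le.trans ?_
  push_cast
  rfl

/-- The sum of `f` over the `2 ^ k` integers from `s` on, by bisection. -/
def dyadicSum (f : ℕ → ℕ) : ℕ → ℕ → ℕ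
  | 0, s => f s
  | k + 1, s => dyadicSum f k s + dyadicSum f k (s + 2 ^ k)

theorem dyadicSum_eq (f : ℕ → ℕ) (k s : ℕ) :
    dyadicSum f k s = ∑ i ∈ range (2 ^ k), f (s + i) := by
  induction k generalizing s with
  | zero => simp [dyadicSum]
  | succ k ih =>
    rw [dyadicSum, ih, ih, pow_succ, mul_two, sum_range_add]
    simp only [add_assoc]

theorem sum_range_3588 (f : ℕ → ℕ) : ∑ i ∈ range 3588, f i =
    dyadicSum f 11 0 + dyadicSum f 10 2048 + dyadicSum f 9 3072 + dyadicSum f 2 3584 := by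
  simp only [dyadicSum_eq]
  rw [show 3588 = 2048 + 1024 + 512 + 4 from rfl, sum_range_add, sum_range_add, sum_range_add]
  simp

theorem sum_range_103 (f : ℕ → ℕ) : ∑ i ∈ range 103, f i =
    dyadicSum f 6 0 + dyadicSum f 5 64 + dyadicSum f 2 96 + dyadicSum f 1 100 + f 102 := by
  simp only [dyadicSum_eq]
  rw [show 103 = 64 + 32 + 4 + 2 + 1 from rfl, sum_range_add, sum_range_add, sum_range_add,
    sum_range_add]
  simp

/-- By Newton's identity the left side is `x ^ 2 - c x` minus the sum of inverse squares, at `x =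
harmonic m`. Since `c ≤ u`, replacing `x` by its upper bound `u` can only increase the quadratic,
despite the negative linear term. -/
theorem two_mul_harmonicTwo_sub_le {m : ℕ} {u l c : ℚ} (hu : harmonic m ≤ u)
    (hl : l ≤ ∑ i ∈ range m, 1 / ((i : ℚ) + 1) ^ 2) (hc : c ≤ u) :
    2 * harmonicTwo m - c * harmonic m ≤ u ^ 2 - c * u - l := by
  have h1 := two_mul_harmonicTwo m
  have h2 : 0 ≤ (u - harmonic m) * (u - c + harmonic m) :=
    mul_nonneg (sub_nonneg.2 hu) (add_nonneg (sub_nonneg.2 hc) (harmonic_nonneg m))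
  nlinarith

theorem harmonic_3588_le : harmonic 3588 ≤ 876271 / 100000 := by
  have h : ∑ i ∈ range 3588, (10 ^ 9 / (i + 1) + 1) ≤ 8762710000 := by
    rw [sum_range_3588]
    decide +kernel
  refine (harmonic_le_of_sum_le (by norm_num) h).trans ?_
  norm_num

theorem two_mul_harmonicTwo_3588_sub_le :
    2 * harmonicTwo 3588 - 1 * harmonic 3588 ≤
      (876271 / 100000) ^ 2 - 1 * (876271 / 100000) - 1644 / 1000 := by
  have h : 1644000000 ≤ ∑ i ∈ range 3588, 10 ^ 9 / (i + 1) ^ 2 := by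
    rw [sum_range_3588]
    decide +kernel
  refine two_mul_harmonicTwo_sub_le harmonic_3588_le
    (le_trans ?_ (le_sum_one_div_sq (by norm_num) h)) ?_ <;> norm_num

theorem harmonic_103_le : harmonic 103 ≤ 5217 / 1000 := by
  have h : ∑ i ∈ range 103, (10 ^ 9 / (i + 1) + 1) ≤ 5217000000 := by
    rw [sum_range_103]
    decide +kernel
  refine (harmonic_le_of_sum_le (by norm_num) h).trans ?_
  norm_num

theorem two_mul_harmonicTwo_103_sub_le :
    2 * harmonicTwo 103 - 17 / 12 * harmonic 103 ≤
      (5217 / 1000) ^ 2 - 17 / 12 * (5217 / 1000) - 1635 / 1000 := by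
  have h : 1635000000 ≤ ∑ i ∈ range 103, 10 ^ 9 / (i + 1) ^ 2 := by
    rw [sum_range_103]
    decide +kernel
  refine two_mul_harmonicTwo_sub_le harmonic_103_le
    (le_trans ?_ (le_sum_one_div_sq (by norm_num) h)) ?_ <;> norm_num

theorem harmonic_le_linear {m₀ m : ℕ} {c : ℚ} (hc : 1 / ((m₀ : ℚ) + 1) ≤ c)
    (h₀ : harmonic m₀ ≤ c * m₀) (hm : m₀ ≤ m) : harmonic m ≤ c * m := by
  induction m, hm using Nat.le_induction with
  | base => exact h₀
  | succ m hm ih =>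
    have h1 : 1 / ((m : ℚ) + 1) ≤ 1 / ((m₀ : ℚ) + 1) :=
      one_div_le_one_div_of_le (by positivity) (by exact_mod_cast Nat.succ_le_succ hm)
    rw [harmonic_succ']
    push_cast
    linarith

theorem harmonic_le_div_108 {m : ℕ} (hm : 3588 ≤ m) : harmonic m ≤ 1 / 108 * m :=
  harmonic_le_linear (m₀ := 3588) (by norm_num) (harmonic_3588_le.trans (by norm_num)) hm

theorem harmonic_le_div_8 {m : ℕ} (hm : 103 ≤ m) : harmonic m ≤ 1 / 8 * m :=
  harmonic_le_linear (m₀ := 103) (by norm_num) (harmonic_103_le.trans (by norm_num)) hm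

theorem harmonic_sq_le {m : ℕ} (hm : 103 ≤ m) : harmonic m ^ 2 ≤ ((m : ℚ) - 1) / 3 := by
  induction m, hm using Nat.le_induction with
  | base =>
    refine (pow_le_pow_left₀ (harmonic_nonneg _) harmonic_103_le 2).trans ?_
    norm_num
  | succ m hm ih =>
    have h1 := harmonic_le_div_8 hm
    have hm' : (103 : ℚ) ≤ m := by exact_mod_cast hm
    have h2 : harmonic m * (1 / ((m : ℚ) + 1)) ≤ 1 / 8 := by
      rw [mul_one_div, div_le_iff₀ (by positivity)]
      linarith
    have h3 : 1 / ((m : ℚ) + 1) ≤ 1 / 104 := one_div_le_one_div_of_le (by norm_num) (by linarith)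
    have h4 : (1 / ((m : ℚ) + 1)) ^ 2 ≤ (1 / 104) ^ 2 := pow_le_pow_left₀ (by positivity) h3 2
    rw [harmonic_succ']
    push_cast
    nlinarith

/-- A step raises the left side by `9 * harmonic m / (m + 1) ≤ 9 / 108 = 1 / 12`, which the linear
term on the right absorbs. The base case holds by less than `1 / 10`. -/
theorem harmonicTwo_lt_linear {m : ℕ} (hm : 3588 ≤ m) :
    9 * harmonicTwo m + 252 / 1000 < (m : ℚ) / 12 + 9 / 2 * harmonic m := by
  induction m, hm using Nat.le_induction with
  | base =>
    have := two_mul_harmonicTwo_3588_sub_le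
    generalize harmonicTwo 3588 = x at *
    generalize harmonic 3588 = y at *
    norm_num at *
    linarith
  | succ m hm ih =>
    have h1 := harmonic_le_div_108 hm
    have hm' : (3588 : ℚ) ≤ m := by exact_mod_cast hm
    have h2 : harmonic m / ((m : ℚ) + 1) ≤ 1 / 108 := by
      rw [div_le_iff₀ (by positivity)]
      linarith
    have h3 : 0 ≤ 1 / ((m : ℚ) + 1) := by positivity
    rw [harmonic_succ', harmonicTwo_succ]
    push_cast
    linarith

/-- A step raises the left side by at most `16 / 8 = 2`, while the quadratic term on the right grows
by `(m - 1) / 36 > 2`. -/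
theorem harmonicTwo_lt_quadratic {m : ℕ} (hm : 103 ≤ m) :
    16 * harmonicTwo m + 27 / 10 <
      1 / 4 + ((m : ℚ) - 2) / 16 + (m - 2) * (m - 1) / 72 + 34 / 3 * harmonic m := by
  induction m, hm using Nat.le_induction with
  | base =>
    have := two_mul_harmonicTwo_103_sub_le
    generalize harmonicTwo 103 = x at *
    generalize harmonic 103 = y at *
    norm_num at *
    linarith
  | succ m hm ih =>
    have h1 := harmonic_le_div_8 hm
    have hm' : (103 : ℚ) ≤ m := by exact_mod_cast hm
    have h2 : harmonic m / ((m : ℚ) + 1) ≤ 1 / 8 := by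
      rw [div_le_iff₀ (by positivity)]
      linarith
    have h3 : 0 ≤ 1 / ((m : ℚ) + 1) := by positivity
    rw [harmonic_succ', harmonicTwo_succ]
    push_cast
    linarith

end Harmonic

/-! ### Comparison of the quadratic coefficients -/

section Inequalities

theorem coeff_two_lt_of_rank_three {b : ℕ} (hb : 3585 ≤ b) :
    (hypersimplexPoly (2 + b + 1) (2 + 1)).coeff 2 < 1 / (((2 : ℕ) + 1 : ℚ) * (b + 1)) *
      (harmonic b + ∑ j ∈ range 2, ((b + j + 1).choose (j + 1) : ℚ) / (j + 1)) := by
  have hb' : (3585 : ℚ) ≤ b := by exact_mod_cast hb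
  -- Here `b + 3 = n - 1`. The coefficient `9 / 2` is `4 + 1 / 2` from the two subtracted terms. The
  -- constant `0.252` covers `1 / 4` plus the cost, at most `5 / 3000`, of shifting harmonic indices
  -- to `b + 3`.
  have h1 := harmonicTwo_lt_linear (m := b + 3) (by omega)
  have e1 := harmonic_succ' b
  have e2 := harmonic_succ' (b + 1)
  have e3 := harmonic_succ' (b + 2)
  have hH := harmonic_nonneg b
  rw [hypersimplexPoly_coeff_two]
  rw [show 2 + b + 1 = b + 3 by omega]
  simp only [sum_range_succ, sum_range_zero, zero_add]
  rw [show 2 + b - 0 = b + 2 by omega, show 2 + b - 1 = b + 1 by omega, harmonic_zero,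
    show harmonic 1 = 1 by simp [harmonic], add_zero, Nat.choose_one_right,
    Nat.cast_choose_two]
  push_cast at *
  have h2 : 1 / 3 + ((b : ℚ) + 2) / 12 ≤ 1 / ((2 + 1) * (b + 1)) *
      (harmonic b + ((b + 1) / (0 + 1) + (b + 1 + 1) * (b + 1 + 1 - 1) / 2 / (1 + 1))) := by
    rw [one_div_mul_eq_div, le_div_iff₀ (by positivity)]
    linarith
  have h3 : 4 * harmonic (b + 2) ≤ ((2 : ℚ) - 0) ^ 2 * (2 + b + 2) / ((0 + 1) * (2 + b + 1 - 0)) *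
      (harmonic (b + 2) - 0) := by
    rw [sub_zero (harmonic _)]
    refine mul_le_mul_of_nonneg_right ?_ (harmonic_nonneg _)
    rw [le_div_iff₀ (by linarith)]
    linarith
  have hH1 : 1 ≤ harmonic (b + 1) := by
    have := harmonic_mono' (show 1 ≤ b + 1 by omega)
    simpa [harmonic] using this
  have h4 : 1 / 2 * (harmonic (b + 1) - 1) ≤ ((2 : ℚ) - 1) ^ 2 * (2 + b + 2) /
      ((1 + 1) * (2 + b + 1 - 1)) * (harmonic (b + 1) - 1) := by
    refine mul_le_mul_of_nonneg_right ?_ (sub_nonneg.2 hH1)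
    rw [le_div_iff₀ (by linarith)]
    linarith
  have i1 : 1 / ((b : ℚ) + 1 + 1) ≤ 1 / 3000 :=
    one_div_le_one_div_of_le (by norm_num) (by linarith)
  have i2 : 1 / ((b : ℚ) + 2 + 1) ≤ 1 / 3000 :=
    one_div_le_one_div_of_le (by norm_num) (by linarith)
  norm_num at *
  linarith

theorem coeff_two_lt_of_rank_four {b : ℕ} (hb : 99 ≤ b) :
    (hypersimplexPoly (3 + b + 1) (3 + 1)).coeff 2 < 1 / (((3 : ℕ) + 1 : ℚ) * (b + 1)) *
      (harmonic b + ∑ j ∈ range 3, ((b + j + 1).choose (j + 1) : ℚ) / (j + 1)) := by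
  have hb' : (99 : ℚ) ≤ b := by exact_mod_cast hb
  -- Here `34 / 3 = 9 + 2 + 1 / 3` from the three subtracted terms. The constant `2.7` covers `2 + 1
  -- / 2` plus index shifts costing at most `14 / 100`.
  have h1 := harmonicTwo_lt_quadratic (m := b + 4) (by omega)
  have e2 := harmonic_succ' (b + 1)
  have e3 := harmonic_succ' (b + 2)
  have e4 := harmonic_succ' (b + 3)
  have hH := harmonic_nonneg b
  have hc : ((b + 2 + 1).choose 3 : ℚ) = (b + 3) * (b + 2) * (b + 1) / 6 := by
    have := Nat.add_one_mul_choose_eq (b + 2) 2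
    have h' : ((b : ℚ) + 2 + 1) * (b + 2).choose 2 = (b + 2 + 1).choose 3 * 3 := by
      exact_mod_cast this
    rw [Nat.cast_choose_two] at h'
    push_cast at h'
    linarith
  rw [hypersimplexPoly_coeff_two]
  rw [show 3 + b + 1 = b + 4 by omega]
  simp only [sum_range_succ, sum_range_zero, zero_add]
  rw [show 3 + b - 0 = b + 3 by omega, show 3 + b - 1 = b + 2 by omega,
    show 3 + b - 2 = b + 1 by omega, harmonic_zero,
    show harmonic 1 = 1 by simp [harmonic],
    show harmonic 2 = 3 / 2 by norm_num [harmonic, sum_range_succ], add_zero,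
    Nat.choose_one_right, Nat.cast_choose_two, show 2 + 1 = 3 from rfl, hc]
  push_cast at *
  have h2 : 1 / 4 + ((b : ℚ) + 2) / 16 + (b + 2) * (b + 3) / 72 ≤ 1 / ((3 + 1) * (b + 1)) *
      (harmonic b + ((b + 1) / (0 + 1) + (b + 1 + 1) * (b + 1 + 1 - 1) / 2 / (1 + 1) +
        (b + 3) * (b + 2) * (b + 1) / 6 / (2 + 1))) := by
    rw [one_div_mul_eq_div, le_div_iff₀ (by positivity)]
    linarith
  have h3 : 9 * harmonic (b + 3) ≤ ((3 : ℚ) - 0) ^ 2 * (3 + b + 2) / ((0 + 1) * (3 + b + 1 - 0)) *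
      (harmonic (b + 3) - 0) := by
    rw [sub_zero (harmonic _)]
    refine mul_le_mul_of_nonneg_right ?_ (harmonic_nonneg _)
    rw [le_div_iff₀ (by linarith)]
    linarith
  have hH1 : 3 / 2 ≤ harmonic (b + 1) := by
    have := harmonic_mono' (show 2 ≤ b + 1 by omega)
    rwa [show harmonic 2 = 3 / 2 by norm_num [harmonic, sum_range_succ]] at this
  have hH2 : harmonic (b + 1) ≤ harmonic (b + 2) := harmonic_mono' (by omega)
  have h4 : 2 * (harmonic (b + 2) - 1) ≤ ((3 : ℚ) - 1) ^ 2 * (3 + b + 2) /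
      ((1 + 1) * (3 + b + 1 - 1)) * (harmonic (b + 2) - 1) := by
    refine mul_le_mul_of_nonneg_right ?_ (by linarith)
    rw [le_div_iff₀ (by linarith)]
    linarith
  have h5 : 1 / 3 * (harmonic (b + 1) - 3 / 2) ≤ ((3 : ℚ) - 2) ^ 2 * (3 + b + 2) /
      ((2 + 1) * (3 + b + 1 - 2)) * (harmonic (b + 1) - 3 / 2) := by
    refine mul_le_mul_of_nonneg_right ?_ (by linarith)
    rw [le_div_iff₀ (by linarith)]
    linarith
  have i1 : 1 / ((b : ℚ) + 1 + 1) ≤ 1 / 100 :=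
    one_div_le_one_div_of_le (by norm_num) (by linarith)
  have i2 : 1 / ((b : ℚ) + 2 + 1) ≤ 1 / 100 :=
    one_div_le_one_div_of_le (by norm_num) (by linarith)
  have i3 : 1 / ((b : ℚ) + 3 + 1) ≤ 1 / 100 :=
    one_div_le_one_div_of_le (by norm_num) (by linarith)
  norm_num at *
  linarith

theorem choose_le_choose_of_le_half {N a b : ℕ} (hab : a ≤ b) (hb : 2 * b ≤ N) :
    N.choose a ≤ N.choose b := by
  induction b, hab using Nat.le_induction with
  | base => exact le_rfl
  | succ b _ ih =>
    exact (ih (by omega)).trans (Nat.choose_le_succ_of_lt_half_left (by omega))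

theorem pow_le_factorial_mul_choose {N a c : ℕ} (h : c + a ≤ N + 1) :
    c ^ a ≤ a.factorial * N.choose a := by
  rw [← Nat.descFactorial_eq_factorial_mul_choose]
  exact (Nat.pow_le_pow_left (by omega) a).trans (Nat.pow_sub_le_descFactorial N a)

/-- For `a < 9` the bound `choose ≥ (b + 1) ^ a / a!` is checked case by case. For `a ≥ 9` the
binomial is at least `M ^ 9 / 9!` with `M = a + b - 8 ≥ 94`, while the left side is at most `2 * M ^
6`. -/
theorem mul_lt_six_mul_choose {a b : ℕ} (ha : 4 ≤ a) (hab : a ≤ b) (hb : 102 ≤ a + b) :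
    (a + 1) ^ 3 * a * (b + 1) * (a + b) < 6 * (a + b).choose a := by
  rcases Nat.lt_or_ge a 9 with ha' | ha'
  · have h1 := pow_le_factorial_mul_choose (N := a + b) (a := a) (c := b + 1) (by omega)
    have h2 : a + b ≤ 2 * (b + 1) := by omega
    have h3 : 95 ≤ b + 1 := by omega
    have h4 : (a + 1) ^ 3 * a * (b + 1) * (a + b) ≤ 2 * ((a + 1) ^ 3 * a) * (b + 1) ^ 2 := by
      calc _ ≤ (a + 1) ^ 3 * a * (b + 1) * (2 * (b + 1)) := Nat.mul_le_mul_left _ h2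
        _ = _ := by ring
    have h5 : 95 ^ (a - 2) * (b + 1) ^ 2 ≤ (b + 1) ^ a := by
      calc _ ≤ (b + 1) ^ (a - 2) * (b + 1) ^ 2 :=
            Nat.mul_le_mul_right _ (Nat.pow_le_pow_left h3 _)
        _ = _ := by rw [← pow_add, Nat.sub_add_cancel (by omega)]
    have h6 : 0 < (b + 1) ^ 2 := by positivity
    clear h2 h3 hb hab
    refine h4.trans_lt ?_
    generalize (b + 1) ^ 2 = q at *
    generalize (a + b).choose a = w at *
    have h7 := h5.trans h1
    clear h1 h5 h4
    interval_cases a <;> norm_num [Nat.factorial] at h7 ⊢ <;> omega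
  · have h0 := choose_le_choose_of_le_half (N := a + b) (a := 9) (b := a) ha' (by omega)
    obtain ⟨M, hM⟩ : ∃ M, a + b = M + 8 := ⟨a + b - 8, by omega⟩
    have h1 := pow_le_factorial_mul_choose (N := a + b) (a := 9) (c := M) (by omega)
    have h2 : (a + 1) ^ 3 * a * (b + 1) * (a + b) ≤ M ^ 3 * M * M * (2 * M) := by
      gcongr <;> omega
    have h3 : 94 ^ 3 * M ^ 6 ≤ M ^ 9 := by
      calc _ ≤ M ^ 3 * M ^ 6 := Nat.mul_le_mul_right _ (Nat.pow_le_pow_left (by omega) _)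
        _ = _ := by ring
    have h4 : M ^ 3 * M * M * (2 * M) = 2 * M ^ 6 := by ring
    have h5 : 0 < M ^ 6 := by
      have : 0 < M := by omega
      positivity
    norm_num [Nat.factorial] at h1 h3
    omega

/-- There is room to drop the subtracted sum on the left and to keep only the last binomial
coefficient on the right. -/
theorem coeff_two_lt_of_rank_ge_five {a b : ℕ} (ha : 4 ≤ a) (hab : a ≤ b) (hb : 102 ≤ a + b) :
    (hypersimplexPoly (a + b + 1) (a + 1)).coeff 2 < 1 / (((a : ℚ) + 1) * (b + 1)) *
      (harmonic b + ∑ j ∈ range a, ((b + j + 1).choose (j + 1) : ℚ) / (j + 1)) := by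
  have h1 : (hypersimplexPoly (a + b + 1) (a + 1)).coeff 2 ≤
      ((a : ℚ) + 1) ^ 2 * ((a + b) / 6) := by
    rw [hypersimplexPoly_coeff_two]
    have h2 : 0 ≤ ∑ j ∈ range a, ((a : ℚ) - j) ^ 2 * (a + b + 2) / ((j + 1) * (a + b + 1 - j)) *
        (harmonic (a + b - j) - harmonic j) := by
      refine sum_nonneg fun j hj ↦ ?_
      rw [mem_range] at hj
      have hj' : (j : ℚ) ≤ a := by exact_mod_cast hj.le
      have : 0 ≤ (a : ℚ) + b + 1 - j := by linarith [(Nat.cast_nonneg b : (0 : ℚ) ≤ b)]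
      exact mul_nonneg (by positivity) (sub_nonneg.2 (harmonic_mono' (by omega)))
    have h3 := harmonicTwo_le (a + b + 1)
    have h4 := harmonic_sq_le (m := a + b + 1) (by omega)
    push_cast at h4
    have h5 : harmonicTwo (a + b + 1) ≤ ((a : ℚ) + b) / 6 := by linarith
    have := mul_le_mul_of_nonneg_left h5 (show 0 ≤ ((a : ℚ) + 1) ^ 2 by positivity)
    linarith
  obtain ⟨c, rfl⟩ : ∃ c, a = c + 1 := ⟨a - 1, by omega⟩
  have h2 : ((c + 1 + b).choose (c + 1) : ℚ) / (c + 1) ≤ harmonic b +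
      ∑ j ∈ range (c + 1), ((b + j + 1).choose (j + 1) : ℚ) / (j + 1) := by
    rw [sum_range_succ, show c + 1 + b = b + c + 1 by omega]
    have h3 : (0 : ℚ) ≤ ∑ j ∈ range c, ((b + j + 1).choose (j + 1) : ℚ) / (j + 1) :=
      sum_nonneg fun j _ ↦ by positivity
    linarith [harmonic_nonneg b]
  have h3 := mul_lt_six_mul_choose ha hab hb
  have h4 : ((c : ℚ) + 1 + 1) ^ 3 * (c + 1) * (b + 1) * (c + 1 + b) <
      6 * (c + 1 + b).choose (c + 1) := by exact_mod_cast h3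
  refine h1.trans_lt (lt_of_lt_of_le ?_ (mul_le_mul_of_nonneg_left h2 (by positivity)))
  push_cast
  rw [one_div_mul_eq_div, div_div, lt_div_iff₀ (by positivity)]
  linarith

theorem coeff_two_lt (a b : ℕ) (hab : a ≤ b)
    (h : (3589 ≤ a + b + 2 ∧ 2 ≤ a) ∨ (104 ≤ a + b + 2 ∧ 3 ≤ a)) :
    (hypersimplexPoly (a + b + 1) (a + 1)).coeff 2 < 1 / (((a : ℚ) + 1) * (b + 1)) *
      (harmonic b + ∑ j ∈ range a, ((b + j + 1).choose (j + 1) : ℚ) / (j + 1)) := by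
  rcases (by omega : (a = 2 ∧ 3585 ≤ b) ∨ (a = 3 ∧ 99 ≤ b) ∨ (4 ≤ a ∧ 102 ≤ a + b)) with
    ⟨rfl, hb⟩ | ⟨rfl, hb⟩ | ⟨ha, hb⟩
  · exact coeff_two_lt_of_rank_three hb
  · exact coeff_two_lt_of_rank_four hb
  · exact coeff_two_lt_of_rank_ge_five ha hab hb

end Inequalities

/-! ### Negativity and the conclusion -/

theorem coeff_two_sub_lt_zero (a b c : ℕ) (hab : a ≤ b)
    (h : (3589 ≤ a + b + 2 ∧ 2 ≤ a) ∨ (104 ≤ a + b + 2 ∧ 3 ≤ a))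
    (hc : (a + b + 2).choose (a + 1) ≤ (a + b + 2) * c) :
    (hypersimplexPoly (a + b + 1) (a + 1) - C (c : ℚ) * cutPoly a b).coeff 2 < 0 := by
  have h1 := coeff_two_lt a b hab h
  -- The absorption identity `n * (n-1).choose a = (a + 1) * n.choose (a + 1)` cancels the `n` in
  -- the bound on the size of the family.
  have h2 : (a + b + 1).choose a ≤ (a + 1) * c := by
    refine Nat.le_of_mul_le_mul_left ?_ (show 0 < a + b + 2 by omega)
    have := Nat.add_one_mul_choose_eq (a + b + 1) a
    rw [this, mul_left_comm, mul_comm]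
    exact Nat.mul_le_mul_left _ hc
  have h3 : ((a + b + 1).choose a : ℚ) ≤ (a + 1) * c := by exact_mod_cast h2
  have h4 : (0 : ℚ) < (a + b + 1).choose a := by exact_mod_cast Nat.choose_pos (by omega)
  have h5 : (0 : ℚ) ≤ harmonic b + ∑ j ∈ range a, ((b + j + 1).choose (j + 1) : ℚ) / (j + 1) := by
    refine add_nonneg (sum_nonneg fun i _ ↦ by positivity) (sum_nonneg fun i _ ↦ by positivity)
  have h6 : 1 / (((a : ℚ) + 1) * (b + 1)) ≤ c * (1 / (((a + b + 1).choose a : ℚ) * (b + 1))) := by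
    rw [mul_one_div, div_le_div_iff₀ (by positivity) (by positivity)]
    nlinarith [mul_le_mul_of_nonneg_right h3 (show (0 : ℚ) ≤ (b : ℚ) + 1 by positivity)]
  rw [coeff_sub, coeff_C_mul, cutPoly_coeff_two]
  have := mul_le_mul_of_nonneg_right h6 h5
  rw [mul_assoc] at this
  linarith

namespace IsExchangeFree

variable {α : Type*} [Fintype α] [DecidableEq α] {F : Finset (Finset α)}

theorem isEhrhartPolynomial_matroid {k l : ℕ} (hF : IsExchangeFree (k + 1) F)
    (h : k + l + 2 = Fintype.card α) :
    IsEhrhartPolynomial (basisPolytope (hF.matroid (by omega) (by omega)))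
      (hypersimplexPoly (k + l + 1) (k + 1) - C (#F : ℚ) * cutPoly k l) := by
  intro t
  obtain ⟨hfin, hcard⟩ := hF.latticePoints_finite_and_ncard h t
  refine ⟨hfin, ?_⟩
  rw [eval_sub, eval_mul, eval_C, cutPoly_eval,
    hypersimplexPoly_eval (α := α) (by omega) (by omega) (by omega), ← hcard]
  push_cast
  ring

/-- Complementing coordinates swaps `k` and `l` in the hypersimplex, and the corner count is
symmetric in them; this reduces the estimates to `a ≤ b`. -/
theorem isEhrhartPolynomial_matroid' {k l : ℕ} (hF : IsExchangeFree (k + 1) F)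
    (h : k + l + 2 = Fintype.card α) :
    IsEhrhartPolynomial (basisPolytope (hF.matroid (by omega) (by omega)))
      (hypersimplexPoly (l + k + 1) (l + 1) - C (#F : ℚ) * cutPoly l k) := by
  intro t
  obtain ⟨hfin, hcard⟩ := hF.latticePoints_finite_and_ncard h t
  refine ⟨hfin, ?_⟩
  rw [card_dilatedHypersimplex_compl (l := l + 1) (by omega)] at hcard
  rw [eval_sub, eval_mul, eval_C, cutPoly_eval,
    hypersimplexPoly_eval (α := α) (by omega) (by omega) (by omega), ← hcard]
  simp only [mul_comm ((_ + l).choose l)]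
  push_cast
  ring

end IsExchangeFree

theorem IsEhrhartPolynomial.unique {α : Type*} {P : Set (α → ℝ)} {p q : ℚ[X]}
    (hp : IsEhrhartPolynomial P p) (hq : IsEhrhartPolynomial P q) : p = q := by
  refine eq_of_infinite_eval_eq p q ((Set.infinite_range_of_injective
    (Nat.cast_injective (R := ℚ))).mono ?_)
  rintro _ ⟨t, rfl⟩
  exact (hp t).2.trans (hq t).2.symm

theorem IsEhrhartPolynomial.not_ehrhartPositive {α : Type*} {P : Set (α → ℝ)} {p : ℚ[X]}
    (hp : IsEhrhartPolynomial P p) {i : ℕ} (hi : p.coeff i < 0) : ¬ EhrhartPositive P := by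
  rintro ⟨q, hq, hpos⟩
  obtain rfl := hp.unique hq
  exact absurd (hpos i (le_natDegree_of_ne_zero hi.ne)) hi.not_gt

theorem exists_ehrhartPolynomial_coeff_two_lt_zero {α : Type*} [Fintype α] [DecidableEq α]
    {F : Finset (Finset α)} {k l : ℕ} (hF : IsExchangeFree (k + 1) F)
    (hcard : k + l + 2 = Fintype.card α) (hF' : (k + l + 2).choose (k + 1) ≤ (k + l + 2) * #F)
    (h : (3589 ≤ k + l + 2 ∧ 2 ≤ k ∧ 2 ≤ l) ∨ (104 ≤ k + l + 2 ∧ 3 ≤ k ∧ 3 ≤ l)) :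
    ∃ p : ℚ[X], IsEhrhartPolynomial (basisPolytope (hF.matroid (by omega) (by omega))) p ∧
      p.coeff 2 < 0 := by
  rcases le_total k l with hkl | hkl
  · exact ⟨_, hF.isEhrhartPolynomial_matroid hcard,
      coeff_two_sub_lt_zero k l _ hkl (by omega) hF'⟩
  · refine ⟨_, hF.isEhrhartPolynomial_matroid' hcard,
      coeff_two_sub_lt_zero l k _ hkl (by omega) ?_⟩
    rw [show l + k + 2 = k + l + 2 by omega, ← Nat.choose_symm_of_eq_add
      (show k + l + 2 = (k + 1) + (l + 1) by omega)]
    exact hF'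

theorem mainTheorem2 (n k : ℕ)
    (h : (3589 ≤ n ∧ 3 ≤ k ∧ k + 3 ≤ n) ∨ (104 ≤ n ∧ 4 ≤ k ∧ k + 4 ≤ n)) :
    ∃ M : Matroid (Fin n), M.E = Set.univ ∧ M.eRank = (k : ℕ∞) ∧ MatroidConnected M ∧
      ¬ EhrhartPositive (basisPolytope M) ∧
      ∃ p : Polynomial ℚ, IsEhrhartPolynomial (basisPolytope M) p ∧ p.coeff 2 < 0 := by
  obtain ⟨F, hF, hF'⟩ := exists_isExchangeFree n k (by omega)
  obtain ⟨k, rfl⟩ : ∃ k', k = k' + 1 := ⟨k - 1, by omega⟩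
  obtain ⟨l, rfl⟩ : ∃ l, n = k + l + 2 := ⟨n - k - 2, by omega⟩
  have hcard : k + l + 2 = Fintype.card (Fin (k + l + 2)) := (Fintype.card_fin _).symm
  obtain ⟨p, hp, hp2⟩ := exists_ehrhartPolynomial_coeff_two_lt_zero hF hcard hF' (by omega)
  exact ⟨hF.matroid (by omega) (by omega), rfl, hF.matroid_eRank _ _,
    hF.matroidConnected_matroid (by omega) (by omega), hp.not_ehrhartPositive hp2, p, hp, hp2⟩
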